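/- Let $(\mathcal K,[\cdot,\cdot])$ be a Krein space, let $\mathcal H$ and $\mathcal H_1,\dots,\mathcal H_m$ be complex Hilbert spaces, and let $T:\mathcal H\to\mathcal K$, $T_j:\mathcal H_j\to\mathcal K$ and $R_j:\mathcal H_j\to\mathcal H$ be bounded, linear and injective with $TR_j=T_j$ for $j=1,\dots,m$. For a bounded operator $S$ denote by $S^+$ its Krein space adjoint (the usual adjoint $S^*$ between Hilbert spaces), and by $D'$ the commutant of an operator $D$, i.e. the algebra of all bounded operators commuting with $D$. Whenever $S$ is a bounded injective operator from a Hilbert space to a Krein (or Hilbert) space and $C\in(SS^+)'$, the operator $S^{-1}CS$ is everywhere defined and bounded, and belongs to $(S^+S)'$. Put $$\Theta(C)=T^{-1}CT\ \ (C\in (TT^+)'),\qquad \Theta_j(C)=T_j^{-1}CT_j\ \ (C\in (T_jT_j^+)'),\qquad \Gamma_j(D)=R_j^{-1}DR_j\ \ (D\in (R_jR_j^*)').$$ Let $j\in\{1,\dots,m\}$ and let $N$ be a bounded operator on $\mathcal K$ which is normal, i.e. $NN^+=N^+N$, and satisfies $N\in (T_jT_j^+)'\cap (TT^+)'$. Then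 $\Theta(N)$ is a normal operator on $\mathcal H$, $\Theta_j(N)$ is a normal operator on $\mathcal H_j$, and $\sigma(\Theta_j(N))\subseteq\sigma(\Theta(N))$. Let $E$ and $E_j$ be the spectral measures of $\Theta(N)$ and $\Theta_j(N)$, respectively. 1. For every Borel set $\Delta\subseteq\mathbb C$ one has $E(\Delta)\in (R_jR_j^*)'\cap (T^+T)'$, $E_j(\Delta)\in (R_j^*R_j)'\cap (T_j^+T_j)'$, and $$\Gamma_j(E(\Delta))=E_j(\Delta).$$ 2. For every bounded and measurable function $h:\sigma(\Theta(N))\to\mathbb C$ one has $\int_{\sigma(\Theta(N))} h\,dE\in (R_jR_j^*)'\cap (T^+T)'$, $\int_{\sigma(\Theta_j(N))} h\,dE_j\in (R_j^*R_j)'\cap (T_j^+T_j)'$, and $$\Gamma_j\left(\int_{\sigma(\Theta(N))} h\,dE\right)=\int_{\sigma(\Theta_j(N))} h\,dE_j .$$ -/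

import Mathlib

open scoped InnerProductSpace ComplexConjugate
open MeasureTheory

noncomputable section

/-- A Krein space: a complex vector space with a Hermitian form `[x, y]` (conjugate-linear in `x`,
linear in `y`) which possesses a fundamental symmetry `J`, i.e. `J² = 1`, `[J x, y] = [x, J y]`, and
`[J x, y]` is a Hilbert space scalar product.  The norm carried by the type is any complete norm
defining the topology of the Krein space: it is equivalent to `√[J x, x]` (the upper estimate
is contained in the continuity of the form and of `J`). -/
class KreinSpace (K : Type*) [NormedAddCommGroup K] [NormedSpace ℂ K] extends
    CompleteSpace K where
  form : K →L⋆[ℂ] K →L[ℂ] ℂ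
  conj_form : ∀ x y, conj (form x y) = form y x
  exists_fundamentalSymmetry : ∃ J : K →L[ℂ] K, (∀ x, J (J x) = x) ∧
    (∀ x y, form (J x) y = form x (J y)) ∧
    ∃ c : ℝ, 0 < c ∧ ∀ x, c * ‖x‖ ^ 2 ≤ (form (J x) x).re

/-- Every Hilbert space is a Krein space, with its scalar product as form and `J = 1`. -/
instance KreinSpace.ofHilbert (H : Type*) [NormedAddCommGroup H] [InnerProductSpace ℂ H]
    [CompleteSpace H] : KreinSpace H where
  form := innerSL ℂ
  conj_form x y := by simp
  exists_fundamentalSymmetry := ⟨1, fun _ => rfl, fun _ _ => rfl, 1, one_pos, fun x => by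
    simp only [one_mul, one_apply_eq_self, innerSL_apply_apply]
    exact (inner_self_eq_norm_sq (𝕜 := ℂ) x).ge⟩

namespace KreinSpace

theorem exists_inner_eq_of_core {F : Type*} [AddCommGroup F] [Module ℂ F] [TopologicalSpace F]
    [IsTopologicalAddGroup F] [ContinuousConstSMul ℂ F] (cd : InnerProductSpace.Core ℂ F)
    (h : ContinuousAt (fun v : F => cd.inner v v) 0)
    (h' : Bornology.IsVonNBounded ℂ {v : F | RCLike.re (cd.inner v v) < 1})
    (hF : @CompleteSpace F (IsTopologicalAddGroup.rightUniformSpace F)) (f : StrongDual ℂ F) :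
    ∃ y, ∀ x, cd.inner y x = f x := by
  let i1 : NormedAddCommGroup F := cd.toNormedAddCommGroupOfTopology h h'
  let i2 : InnerProductSpace ℂ F := InnerProductSpace.ofCoreOfTopology cd h h'
  have hc : CompleteSpace F := by
    rw [IsUniformAddGroup.rightUniformSpace_eq (G := F)] at hF
    exact hF
  exact ⟨(InnerProductSpace.toDual ℂ F).symm f,
    fun x => InnerProductSpace.toDual_symm_apply (𝕜 := ℂ) (E := F)⟩

section Riesz

variable {K : Type*} [NormedAddCommGroup K] [NormedSpace ℂ K] [KreinSpace K]

/-- Riesz representation in a Krein space. -/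
theorem form_bijective : Function.Bijective (form (K := K)) := by
  obtain ⟨J, hJJ, hJ, c, hc, hcJ⟩ := exists_fundamentalSymmetry (K := K)
  have hpos : ∀ x : K, 0 ≤ (form (J x) x).re := fun x => le_trans (by positivity) (hcJ x)
  let core : InnerProductSpace.Core ℂ K :=
    { inner := fun x y => form (J x) y
      conj_inner_symm := fun x y => by
        change conj (form (J y) x) = form (J x) y
        rw [conj_form, hJ]
      re_inner_nonneg := hpos
      add_left := fun x y z => by simp
      smul_left := fun x y r => by simp
      definite := fun x hx => by
        have h0 : form (J x) x = 0 := hx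
        have := hcJ x
        rw [h0] at this
        have h2 : ‖x‖ ^ 2 ≤ 0 := by
          by_contra h
          push Not at h
          have := mul_pos hc h
          simp at *
          linarith
        have : ‖x‖ = 0 := by nlinarith [norm_nonneg x]
        simpa using this }
  have hcont : ContinuousAt (fun x : K => form (J x) x) 0 := by fun_prop
  have hbdd : Bornology.IsVonNBounded ℂ {v : K | (form (J v) v).re < 1} := by
    rw [NormedSpace.isVonNBounded_iff ℂ, isBounded_iff_forall_norm_le]
    refine ⟨1 / c + 1, fun x hx => ?_⟩
    have h1 := hcJ x
    have h2 : (form (J x) x).re < 1 := hx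
    have h3 : c * ‖x‖ ^ 2 < 1 := h1.trans_lt h2
    have h4 : ‖x‖ ^ 2 < 1 / c := by rw [lt_div_iff₀ hc]; linarith
    nlinarith [norm_nonneg x, sq_nonneg (‖x‖ - 1)]
  have hK : @CompleteSpace K (IsTopologicalAddGroup.rightUniformSpace K) := by
    rw [IsUniformAddGroup.rightUniformSpace_eq]
    infer_instance
  constructor
  · intro x y hxy
    have h0 : form (J (J (x - y))) (J (x - y)) = 0 := by
      simp [hJJ, hxy]
    have h1 := core.definite _ h0
    have h2 := hJJ (x - y)
    rw [h1, map_zero] at h2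
    exact (sub_eq_zero.mp h2.symm)
  · intro f
    obtain ⟨y, hy⟩ := exists_inner_eq_of_core core hcont hbdd hK f
    exact ⟨J y, ContinuousLinearMap.ext hy⟩

/-- The isomorphism `x ↦ [x, ·]` of a Krein space onto its (conjugate) dual. -/
def toDual (K : Type*) [NormedAddCommGroup K] [NormedSpace ℂ K] [KreinSpace K] :
    K ≃L⋆[ℂ] StrongDual ℂ K :=
  ContinuousLinearEquiv.ofBijective form
    (LinearMap.ker_eq_bot.mpr form_bijective.1) (LinearMap.range_eq_top.mpr form_bijective.2)

theorem form_toDual_symm (f : StrongDual ℂ K) (x : K) : form ((toDual K).symm f) x = f x := by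
  have h : toDual K ((toDual K).symm f) = f := (toDual K).apply_symm_apply f
  exact congrArg (fun g : StrongDual ℂ K => g x) h

theorem form_ext_left {x y : K} (h : ∀ z, form x z = form y z) : x = y :=
  form_bijective.1 (ContinuousLinearMap.ext h)

theorem form_ext_right {x y : K} (h : ∀ z, form z x = form z y) : x = y :=
  form_ext_left fun z => by rw [← conj_form z x, ← conj_form z y, h]

end Riesz

variable {K₁ K₂ : Type*} [NormedAddCommGroup K₁] [NormedSpace ℂ K₁] [KreinSpace K₁]
  [NormedAddCommGroup K₂] [NormedSpace ℂ K₂] [KreinSpace K₂]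

/-- The Krein space adjoint `T⁺` of a bounded operator `T`, i.e. `[T x, y] = [x, T⁺ y]`. -/
def adjoint (T : K₁ →L[ℂ] K₂) : K₂ →L[ℂ] K₁ :=
  (toDual K₁).symm.toContinuousLinearMap.comp
    ((((ContinuousLinearMap.compL ℂ K₁ K₂ ℂ).flip T).comp form : K₂ →L⋆[ℂ] StrongDual ℂ K₁))

theorem form_adjoint_left (T : K₁ →L[ℂ] K₂) (x : K₂) (y : K₁) :
    form (adjoint T x) y = form x (T y) :=
  form_toDual_symm _ _

theorem form_adjoint_right (T : K₁ →L[ℂ] K₂) (x : K₁) (y : K₂) :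
    form x (adjoint T y) = form (T x) y := by
  rw [← conj_form, form_adjoint_left, conj_form]

/-- For operators between Hilbert spaces the Krein space adjoint is the usual adjoint. -/
theorem adjoint_eq_hilbert_adjoint {H₁ H₂ : Type*} [NormedAddCommGroup H₁]
    [InnerProductSpace ℂ H₁] [CompleteSpace H₁] [NormedAddCommGroup H₂] [InnerProductSpace ℂ H₂]
    [CompleteSpace H₂] (T : H₁ →L[ℂ] H₂) : adjoint T = ContinuousLinearMap.adjoint T :=
  ContinuousLinearMap.ext fun y => form_ext_right fun z =>
    (form_adjoint_right T z y).trans (ContinuousLinearMap.adjoint_inner_right T z y).symm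

/-- The commutant `D'` of a bounded operator `D`. -/
abbrev commutant {K : Type*} [NormedAddCommGroup K] [NormedSpace ℂ K] (D : K →L[ℂ] K) :
    Subalgebra ℂ (K →L[ℂ] K) :=
  Subalgebra.centralizer ℂ {D}

theorem mem_commutant {K : Type*} [NormedAddCommGroup K] [NormedSpace ℂ K] {D C : K →L[ℂ] K} :
    C ∈ commutant D ↔ D * C = C * D := by
  simp [Subalgebra.mem_centralizer_iff]

section Transport

variable {K H : Type*} [NormedAddCommGroup K] [NormedSpace ℂ K] [KreinSpace K]
  [NormedAddCommGroup H] [InnerProductSpace ℂ H] [CompleteSpace H]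

theorem norm_adjoint_comp_le {T : H →L[ℂ] K} {C : K →L[ℂ] K}
    (hC : C ∈ commutant (T ∘L adjoint T)) :
    ∃ M : ℝ, ∀ x, ‖adjoint T (C x)‖ ≤ M * ‖adjoint T x‖ := by
  have hC' : ∀ x, T (adjoint T (C x)) = C (T (adjoint T x)) := fun x =>
    congrArg (fun D : K →L[ℂ] K => D x) (mem_commutant.mp hC)
  have hin : ∀ x y : K, ⟪adjoint T x, adjoint T y⟫_ℂ = form x (T (adjoint T y)) := fun x y =>
    form_adjoint_left T x (adjoint T y)
  have hin' : ∀ x y : K, ⟪adjoint T x, adjoint T y⟫_ℂ = form (T (adjoint T x)) y := fun x y =>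
    form_adjoint_right T (adjoint T x) y
  let S : K →L[ℂ] K := adjoint C ∘L C
  have hS : ∀ x y, ⟪adjoint T (S x), adjoint T y⟫_ℂ
      = ⟪adjoint T (C x), adjoint T (C y)⟫_ℂ := fun x y => by
    rw [hin, hin, hC', ← form_adjoint_left C]
    rfl
  have hS' : ∀ x y, ⟪adjoint T x, adjoint T (S y)⟫_ℂ
      = ⟪adjoint T (C x), adjoint T (C y)⟫_ℂ := fun x y => by
    rw [hin', hin', hC', ← form_adjoint_right C]
    rfl
  -- logarithmic convexity of the norms of the iterates of `S`
  have key : ∀ x, ‖adjoint T (S x)‖ ^ 2 ≤ ‖adjoint T x‖ * ‖adjoint T (S (S x))‖ := fun x => by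
    have h1 : ⟪adjoint T (S x), adjoint T (S x)⟫_ℂ = ⟪adjoint T x, adjoint T (S (S x))⟫_ℂ := by
      rw [hS, hS']
    have h2 := inner_self_eq_norm_sq_to_K (𝕜 := ℂ) (adjoint T (S x))
    rw [h1] at h2
    have h3 := norm_inner_le_norm (𝕜 := ℂ) (adjoint T x) (adjoint T (S (S x)))
    rw [h2] at h3
    simpa using h3
  have hSb : ∀ x, ‖adjoint T (S x)‖ ≤ ‖S‖ * ‖adjoint T x‖ := fun x => by
    by_contra! hlt
    let u : ℕ → ℝ := fun n => ‖adjoint T ((S ^ n) x)‖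
    have hu : ∀ n, u (n + 1) ^ 2 ≤ u n * u (n + 2) := fun n => by
      have := key ((S ^ n) x)
      simpa only [u, pow_succ', mul_apply_eq_comp] using this
    have hu0 : 0 < u 0 := by
      by_contra! h0
      have h0' : u 0 = 0 := le_antisymm h0 (norm_nonneg _)
      have := hu 0
      rw [h0', zero_mul] at this
      have h1 : u 1 = 0 := by
        have : u 1 ^ 2 = 0 := le_antisymm this (sq_nonneg _)
        simpa using this
      have h0'' : ‖adjoint T x‖ = 0 := by simpa [u] using h0'
      have h1' : ‖adjoint T (S x)‖ = 0 := by simpa [u] using h1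
      rw [h0'', h1', mul_zero] at hlt
      exact lt_irrefl _ hlt
    set r : ℝ := u 1 / u 0 with hr
    have hrS : ‖S‖ < r := by
      rw [hr, lt_div_iff₀ hu0]
      simpa [u] using hlt
    have hr0 : 0 < r := (norm_nonneg _).trans_lt hrS
    have hstep : ∀ n, 0 < u n ∧ r * u n ≤ u (n + 1) := fun n => by
      induction n with
      | zero => exact ⟨hu0, by rw [hr, div_mul_cancel₀ _ hu0.ne']⟩
      | succ n ih =>
        obtain ⟨h1, h2⟩ := ih
        have h3 : 0 < u (n + 1) := lt_of_lt_of_le (mul_pos hr0 h1) h2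
        refine ⟨h3, ?_⟩
        have h4 := hu n
        have h5 : r * u n * u (n + 1) ≤ u (n + 1) ^ 2 := by
          rw [sq]
          exact mul_le_mul_of_nonneg_right h2 h3.le
        have h6 : u n * (r * u (n + 1)) ≤ u n * u (n + 2) := by linarith
        exact le_of_mul_le_mul_left h6 h1
    have hlow : ∀ n, r ^ n * u 0 ≤ u n := fun n => by
      induction n with
      | zero => simp
      | succ n ih =>
        calc r ^ (n + 1) * u 0 = r * (r ^ n * u 0) := by ring
          _ ≤ r * u n := by gcongr
          _ ≤ u (n + 1) := (hstep n).2
    have hup : ∀ n, u n ≤ ‖adjoint T‖ * ‖x‖ * ‖S‖ ^ n := fun n => by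
      induction n with
      | zero => simpa [u] using (adjoint T).le_opNorm x
      | succ n ih =>
        calc u (n + 1) ≤ ‖adjoint T‖ * ‖(S ^ (n + 1)) x‖ := (adjoint T).le_opNorm _
          _ ≤ ‖adjoint T‖ * (‖S ^ (n + 1)‖ * ‖x‖) := by gcongr; exact (S ^ (n + 1)).le_opNorm x
          _ ≤ ‖adjoint T‖ * (‖S‖ ^ (n + 1) * ‖x‖) := by
              gcongr; exact norm_pow_le' S (Nat.succ_pos n)
          _ = _ := by ring
    have hlim : Filter.Tendsto (fun n : ℕ => ‖adjoint T‖ * ‖x‖ * (‖S‖ / r) ^ n) Filter.atTop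
        (nhds (‖adjoint T‖ * ‖x‖ * 0)) :=
      (tendsto_pow_atTop_nhds_zero_of_lt_one (by positivity)
        ((div_lt_one hr0).mpr hrS)).const_mul _
    rw [mul_zero] at hlim
    refine absurd (ge_of_tendsto' hlim fun n => ?_) (not_le.mpr hu0)
    have h1 := (hlow n).trans (hup n)
    rw [div_pow, mul_div_assoc', le_div_iff₀ (pow_pos hr0 n)]
    linarith
  refine ⟨√‖S‖, fun x => ?_⟩
  have h1 : ‖adjoint T (C x)‖ ^ 2 ≤ ‖S‖ * ‖adjoint T x‖ ^ 2 := by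
    have h2 := inner_self_eq_norm_sq_to_K (𝕜 := ℂ) (adjoint T (C x))
    rw [← hS] at h2
    have h3 := norm_inner_le_norm (𝕜 := ℂ) (adjoint T (S x)) (adjoint T x)
    rw [h2] at h3
    have h4 : ‖adjoint T (C x)‖ ^ 2 ≤ ‖adjoint T (S x)‖ * ‖adjoint T x‖ := by simpa using h3
    nlinarith [hSb x, norm_nonneg (adjoint T x)]
  rw [← Real.sqrt_sq (norm_nonneg (adjoint T x)), ← Real.sqrt_mul (norm_nonneg _)]
  exact Real.le_sqrt_of_sq_le h1

theorem denseRange_adjoint {T : H →L[ℂ] K} (hT : Function.Injective T) :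
    DenseRange (adjoint T) := by
  have h : (adjoint T).range.topologicalClosure = ⊤ := by
    rw [Submodule.topologicalClosure_eq_top_iff, Submodule.eq_bot_iff]
    intro x hx
    apply hT
    rw [map_zero]
    refine form_ext_left fun y => ?_
    have h1 : ⟪x, adjoint T y⟫_ℂ = 0 :=
      (Submodule.mem_orthogonal' _ _).mp hx _ (LinearMap.mem_range_self _ y)
    rw [map_zero]
    exact (form_adjoint_right T x y).symm.trans h1
  intro x
  have : x ∈ (adjoint T).range.topologicalClosure := h ▸ Submodule.mem_top
  exact this

theorem exists_extension {X Y Z : Type*} [NormedAddCommGroup X] [NormedSpace ℂ X]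
    [NormedAddCommGroup Y] [NormedSpace ℂ Y] [NormedAddCommGroup Z] [NormedSpace ℂ Z]
    [CompleteSpace Z] (e : X →L[ℂ] Y) (f : X →L[ℂ] Z) (he : DenseRange e)
    (hf : ∃ M : ℝ, ∀ x, ‖f x‖ ≤ M * ‖e x‖) : ∃ D : Y →L[ℂ] Z, ∀ x, D (e x) = f x :=
  ⟨f.toLinearMap.extendOfNorm e.toLinearMap, fun x =>
    LinearMap.extendOfNorm_eq (f := f.toLinearMap) (e := e.toLinearMap) he hf x⟩

/-- For `C` in the commutant of `T T⁺` the operator `T⁻¹ C T` is everywhere defined and bounded,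
and it lies in the commutant of `T⁺ T`. -/
theorem exists_transport {T : H →L[ℂ] K} (hT : Function.Injective T) {C : K →L[ℂ] K}
    (hC : C ∈ commutant (T ∘L adjoint T)) :
    ∃ D : commutant (adjoint T ∘L T), ∀ x, T ((D : H →L[ℂ] H) x) = C (T x) := by
  have hC' : ∀ x, T (adjoint T (C x)) = C (T (adjoint T x)) := fun x =>
    congrArg (fun D : K →L[ℂ] K => D x) (mem_commutant.mp hC)
  obtain ⟨D, hD⟩ := exists_extension (adjoint T) (adjoint T ∘L C) (denseRange_adjoint hT)
    (by simpa only [ContinuousLinearMap.comp_apply] using norm_adjoint_comp_le hC)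
  simp only [ContinuousLinearMap.comp_apply] at hD
  have hTD : ∀ x, T (D x) = C (T x) := fun x => by
    have h : (fun x => T (D x)) = fun x => C (T x) :=
      (denseRange_adjoint hT).equalizer (T.continuous.comp D.continuous)
        (C.continuous.comp T.continuous)
        (funext fun x => by simp only [Function.comp, hD, hC'])
    exact congrFun h x
  refine ⟨⟨D, mem_commutant.mpr (ContinuousLinearMap.ext fun x => ?_)⟩, hTD⟩
  simp only [mul_apply_eq_comp, ContinuousLinearMap.comp_apply, hD, hTD]

/-- The map `(T T⁺)' → (T⁺ T)'`, `C ↦ (T × T)⁻¹(C) = T⁻¹ C T`, for a bounded injective operator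
`T` from a Hilbert space to a Krein space. -/
def transport (T : H →L[ℂ] K) (hT : Function.Injective T)
    (C : commutant (T ∘L adjoint T)) : commutant (adjoint T ∘L T) :=
  (exists_transport hT C.2).choose

theorem apply_transport (T : H →L[ℂ] K) (hT : Function.Injective T)
    (C : commutant (T ∘L adjoint T)) (x : H) :
    T ((transport T hT C : H →L[ℂ] H) x) = (C : K →L[ℂ] K) (T x) :=
  (exists_transport hT C.2).choose_spec x

end Transport

end KreinSpace

theorem ext_quadratic {H : Type*} [NormedAddCommGroup H] [InnerProductSpace ℂ H]
    {A B : H →L[ℂ] H} (h : ∀ x, ⟪x, A x⟫_ℂ = ⟪x, B x⟫_ℂ) : A = B := by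
  have h1 : (A : H →ₗ[ℂ] H) = (B : H →ₗ[ℂ] H) := (ext_inner_map _ _).mp fun x => by
    have := congrArg conj (h x)
    simpa using this
  exact ContinuousLinearMap.coe_injective h1

section Weak

variable {H : Type*} [NormedAddCommGroup H] [InnerProductSpace ℂ H] [CompleteSpace H]

/-- If the quadratic forms of a sequence of bounded operators converge pointwise, then the sequence
converges in the weak operator topology. -/
theorem exists_tendsto_weakly (A' : ℕ → H →L[ℂ] H) (q : H → ℂ)
    (h' : ∀ x, Filter.Tendsto (fun n => ⟪x, A' n x⟫_ℂ) Filter.atTop (nhds (q x))) :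
    ∃ B : H →L[ℂ] H, ∀ x y,
      Filter.Tendsto (fun n => ⟪x, A' n y⟫_ℂ) Filter.atTop (nhds ⟪x, B y⟫_ℂ) := by
  let A : ℕ → H →L[ℂ] H := fun n => ContinuousLinearMap.adjoint (A' n)
  have h : ∀ x, Filter.Tendsto (fun n => ⟪A n x, x⟫_ℂ) Filter.atTop (nhds (q x)) := fun x => by
    simpa only [A, ContinuousLinearMap.adjoint_inner_left] using h' x

  have h1 : ∀ x y, ∃ b, Filter.Tendsto (fun n => ⟪A n x, y⟫_ℂ) Filter.atTop (nhds b) :=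
    fun x y => by
      refine ⟨(q (x + y) - q (x - y) - Complex.I * q (x + Complex.I • y)
        + Complex.I * q (x - Complex.I • y)) / 4, ?_⟩
      have e : (fun n => ⟪A n x, y⟫_ℂ) = fun n => (⟪A n (x + y), x + y⟫_ℂ
          - ⟪A n (x - y), x - y⟫_ℂ
          - Complex.I * ⟪A n (x + Complex.I • y), x + Complex.I • y⟫_ℂ
          + Complex.I * ⟪A n (x - Complex.I • y), x - Complex.I • y⟫_ℂ) / 4 :=
        funext fun n => inner_map_polarization' (A n : H →ₗ[ℂ] H) x y
      rw [e]
      exact ((((h _).sub (h _)).sub ((h _).const_mul _)).add ((h _).const_mul _)).div_const _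
  choose b hb using h1
  have h2 : ∀ x, ∃ C, ∀ n, ‖A n x‖ ≤ C := fun x => by
    obtain ⟨C, hC⟩ := banach_steinhaus (g := fun n => innerSL ℂ (A n x)) fun y => by
      obtain ⟨C, hC⟩ := (hb x y).norm.bddAbove_range
      exact ⟨C, fun n => by simpa using hC (Set.mem_range_self n)⟩
    exact ⟨C, fun n => by simpa using hC n⟩
  obtain ⟨C, hC⟩ := banach_steinhaus h2
  have hbound : ∀ x y, ‖b x y‖ ≤ C * ‖x‖ * ‖y‖ := fun x y => by
    refine le_of_tendsto (hb x y).norm (Filter.Eventually.of_forall fun n => ?_)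
    refine (norm_inner_le_norm _ _).trans ?_
    gcongr
    exact (A n).le_of_opNorm_le (hC n) x
  let B : H →L⋆[ℂ] H →L[ℂ] ℂ := LinearMap.mkContinuous₂
    (LinearMap.mk₂'ₛₗ (starRingEnd ℂ) (RingHom.id ℂ) b
      (fun x x' y => tendsto_nhds_unique (hb _ _) (by
        simpa [inner_add_left] using (hb x y).add (hb x' y)))
      (fun c x y => tendsto_nhds_unique (hb _ _) (by
        simpa [inner_smul_left, mul_comm] using (hb x y).const_mul (conj c)))
      (fun x y y' => tendsto_nhds_unique (hb _ _) (by
        simpa [inner_add_right] using (hb x y).add (hb x y')))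
      (fun c x y => tendsto_nhds_unique (hb _ _) (by
        simpa [inner_smul_right] using (hb x y).const_mul c))) C hbound
  refine ⟨ContinuousLinearMap.adjoint (InnerProductSpace.continuousLinearMapOfBilin B),
    fun x y => ?_⟩
  have e : ⟪x, ContinuousLinearMap.adjoint (InnerProductSpace.continuousLinearMapOfBilin B) y⟫_ℂ
      = b x y := by
    rw [ContinuousLinearMap.adjoint_inner_right,
      InnerProductSpace.continuousLinearMapOfBilin_apply]
    rfl
  rw [e]
  simpa only [A, ContinuousLinearMap.adjoint_inner_left] using hb x y

end Weak

/-- A spectral measure on `ℂ`: a map `E` assigning orthogonal projections of the Hilbert space `H`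
to the Borel subsets of `ℂ`, with `E(ℂ) = 1`, multiplicative and countably additive in the strong
operator topology.  (Only the values on Borel sets are meaningful.) -/
structure SpectralMeasure (H : Type*) [NormedAddCommGroup H] [InnerProductSpace ℂ H]
    [CompleteSpace H] where
  proj : Set ℂ → H →L[ℂ] H
  isStarProjection : ∀ Δ, MeasurableSet Δ → IsStarProjection (proj Δ)
  proj_univ : proj Set.univ = 1
  proj_inter : ∀ Δ₁ Δ₂, MeasurableSet Δ₁ → MeasurableSet Δ₂ →
    proj (Δ₁ ∩ Δ₂) = proj Δ₁ * proj Δ₂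
  proj_iUnion : ∀ Δ : ℕ → Set ℂ, (∀ n, MeasurableSet (Δ n)) → Pairwise (Function.onFun Disjoint Δ) →
    ∀ x, HasSum (fun n => proj (Δ n) x) (proj (⋃ n, Δ n) x)

namespace SpectralMeasure

variable {H : Type*} [NormedAddCommGroup H] [InnerProductSpace ℂ H] [CompleteSpace H]

instance : CoeFun (SpectralMeasure H) (fun _ => Set ℂ → H →L[ℂ] H) := ⟨proj⟩

variable (E : SpectralMeasure H)

theorem inner_proj (x : H) {Δ : Set ℂ} (hΔ : MeasurableSet Δ) :
    ⟪x, E Δ x⟫_ℂ = (‖E Δ x‖ : ℂ) ^ 2 := by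
  have h := E.isStarProjection Δ hΔ
  have h1 : E Δ (E Δ x) = E Δ x := congrArg (fun D : H →L[ℂ] H => D x) h.isIdempotentElem
  have h2 := ContinuousLinearMap.adjoint_inner_left (E Δ) (E Δ x) x
  rw [← ContinuousLinearMap.star_eq_adjoint, h.isSelfAdjoint.star_eq, h1] at h2
  rw [← h2, inner_self_eq_norm_sq_to_K]
  rfl

theorem proj_empty_apply (x : H) : E ∅ x = 0 := by
  have h := E.proj_iUnion (fun _ => ∅) (fun _ => MeasurableSet.empty)
    (fun _ _ _ => disjoint_bot_left) x
  simpa using summable_const_iff _ |>.mp h.summable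

/-- The finite positive Borel measure `Δ ↦ (E(Δ) x, x) = ‖E(Δ) x‖²`. -/
def scalarMeasure (x : H) : Measure ℂ :=
  Measure.ofMeasurable (fun Δ _ => ENNReal.ofReal (‖E Δ x‖ ^ 2))
    (by simp [proj_empty_apply])
    (fun Δ hΔ hd => by
      have h1 := (innerSL ℂ x).hasSum (E.proj_iUnion Δ hΔ hd x)
      simp only [innerSL_apply_apply, E.inner_proj x (hΔ _),
        E.inner_proj x (MeasurableSet.iUnion hΔ)] at h1
      have h2 : HasSum (fun n => ‖E (Δ n) x‖ ^ 2) (‖E (⋃ n, Δ n) x‖ ^ 2) := by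
        exact_mod_cast h1
      rw [← h2.tsum_eq, ENNReal.ofReal_tsum_of_nonneg (fun n => sq_nonneg _) h2.summable])

theorem scalarMeasure_apply (x : H) {Δ : Set ℂ} (hΔ : MeasurableSet Δ) :
    E.scalarMeasure x Δ = ENNReal.ofReal (‖E Δ x‖ ^ 2) :=
  Measure.ofMeasurable_apply Δ hΔ

instance (x : H) : IsFiniteMeasure (E.scalarMeasure x) :=
  ⟨by rw [E.scalarMeasure_apply x MeasurableSet.univ]; exact ENNReal.ofReal_lt_top⟩

/-- Existence of `∫ h dE` for bounded measurable `h`. -/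
theorem exists_integral (h : ℂ → ℂ) (hm : Measurable h) (hb : ∃ M, ∀ z, ‖h z‖ ≤ M) :
    ∃ A : H →L[ℂ] H, ∀ x, ⟪x, A x⟫_ℂ = ∫ z, h z ∂(E.scalarMeasure x) := by
  obtain ⟨M, hM⟩ := hb
  let s : ℕ → SimpleFunc ℂ ℂ := SimpleFunc.approxOn h hm Set.univ 0 (Set.mem_univ 0)
  have hs : ∀ z, Filter.Tendsto (fun n => s n z) Filter.atTop (nhds (h z)) := fun z =>
    SimpleFunc.tendsto_approxOn hm (Set.mem_univ 0) (by simp)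
  have hsb : ∀ n z, ‖s n z‖ ≤ M + M := fun n z =>
    (SimpleFunc.norm_approxOn_zero_le hm (Set.mem_univ 0) z n).trans (by gcongr <;> exact hM z)
  let A : ℕ → H →L[ℂ] H := fun n => ∑ c ∈ (s n).range, c • E (s n ⁻¹' {c})
  have hA : ∀ n x, ⟪x, A n x⟫_ℂ = ∫ z, s n z ∂(E.scalarMeasure x) := fun n x => by
    rw [← SimpleFunc.integral_eq_integral _ (SimpleFunc.integrable_of_isFiniteMeasure _),
      SimpleFunc.integral_eq]
    simp only [A, sum_apply, inner_sum, smul_apply,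
      inner_smul_right]
    refine Finset.sum_congr rfl fun c _ => ?_
    rw [E.inner_proj x ((s n).measurableSet_fiber c), Measure.real,
      E.scalarMeasure_apply x ((s n).measurableSet_fiber c), ENNReal.toReal_ofReal (sq_nonneg _),
      Complex.real_smul, mul_comm]
    push_cast
    rfl
  have hlim : ∀ x, Filter.Tendsto (fun n => ⟪x, A n x⟫_ℂ) Filter.atTop
      (nhds (∫ z, h z ∂(E.scalarMeasure x))) := fun x => by
    simp only [hA]
    exact tendsto_integral_of_dominated_convergence (fun _ => M + M)
      (fun n => (s n).aestronglyMeasurable) (integrable_const _)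
      (fun n => Filter.Eventually.of_forall (hsb n)) (Filter.Eventually.of_forall hs)
  obtain ⟨B, hB⟩ := exists_tendsto_weakly A _ hlim
  exact ⟨B, fun x => tendsto_nhds_unique (hB x x) (hlim x)⟩

open Classical in
/-- The operator `∫ h dE` for a bounded and measurable function `h`, i.e. the bounded operator with
`((∫ h dE) x, x) = ∫ h(z) d(E(z) x, x)` for all `x` (and `0` for all other functions `h`). -/
def integral (h : ℂ → ℂ) : H →L[ℂ] H :=
  if hh : Measurable h ∧ ∃ M, ∀ z, ‖h z‖ ≤ M then (E.exists_integral h hh.1 hh.2).choose else 0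

theorem inner_integral {h : ℂ → ℂ} (hm : Measurable h) (hb : ∃ M, ∀ z, ‖h z‖ ≤ M) (x : H) :
    ⟪x, E.integral h x⟫_ℂ = ∫ z, h z ∂(E.scalarMeasure x) := by
  rw [integral, dif_pos ⟨hm, hb⟩]
  exact (E.exists_integral h hm hb).choose_spec x

/-- The operator `∫_S h dE`; only the values of `h` on `S` matter. -/
def integralOn (S : Set ℂ) (h : ℂ → ℂ) : H →L[ℂ] H :=
  E.integral (S.indicator h)

/-- `E` is the spectral measure of the operator `A`: it is concentrated on the spectrum of `A`,
and `A = ∫_{σ(A)} z dE(z)`. -/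
def IsSpectralMeasureOf (A : H →L[ℂ] H) : Prop :=
  E (spectrum ℂ A)ᶜ = 0 ∧ E.integralOn (spectrum ℂ A) (fun z => z) = A

end SpectralMeasure

section SpectralTheorem

variable {H : Type*} [NormedAddCommGroup H] [InnerProductSpace ℂ H] [CompleteSpace H]

theorem exists_measure_of_starAlgHom {X : Type*} [TopologicalSpace X] [CompactSpace X] [T2Space X]
    [MeasurableSpace X] [BorelSpace X] (φ : C(X, ℂ) →⋆ₐ[ℂ] (H →L[ℂ] H)) (x : H) :
    ∃ μ : Measure X, IsFiniteMeasure μ ∧ ∀ f : C(X, ℂ), ∫ z, f z ∂μ = ⟪x, φ f x⟫_ℂ := by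
  let ι : C(X, ℝ) → C(X, ℂ) := fun f => ⟨fun z => (f z : ℂ), by fun_prop⟩
  have hreal : ∀ f : C(X, ℝ), ((⟪x, φ (ι f) x⟫_ℂ).re : ℂ) = ⟪x, φ (ι f) x⟫_ℂ := fun f => by
    have h1 : star (ι f) = ι f := by ext z; simp [ι]
    have h2 : ContinuousLinearMap.adjoint (φ (ι f)) = φ (ι f) := by
      rw [← ContinuousLinearMap.star_eq_adjoint, ← map_star, h1]
    rw [← Complex.conj_eq_iff_re, inner_conj_symm]
    conv_lhs => rw [← h2]
    rw [ContinuousLinearMap.adjoint_inner_left]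
  let Λ : CompactlySupportedContinuousMap X ℝ →ₚ[ℝ] ℝ := PositiveLinearMap.mk₀
    { toFun := fun f => (⟪x, φ (ι f.toContinuousMap) x⟫_ℂ).re
      map_add' := fun f g => by
        have : ι (f + g).toContinuousMap = ι f.toContinuousMap + ι g.toContinuousMap := by
          ext z; simp [ι]
        rw [this, map_add, add_apply, inner_add_right, Complex.add_re]
      map_smul' := fun c f => by
        have : ι (c • f).toContinuousMap = (c : ℂ) • ι f.toContinuousMap := by
          ext z; simp [ι]
        rw [this, map_smul, smul_apply, inner_smul_right, Complex.re_ofReal_mul]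
        rfl }
    fun f hf => by
      let g : C(X, ℝ) := ⟨fun z => √(f z), by fun_prop⟩
      have h1 : ι f.toContinuousMap = star (ι g) * ι g := by
        ext z
        have : √(f z) * √(f z) = f z := Real.mul_self_sqrt (hf z)
        simp only [ι, g, ContinuousMap.mul_apply, ContinuousMap.star_apply, ContinuousMap.coe_mk,
          Complex.star_def, Complex.conj_ofReal, ← Complex.ofReal_mul, this]
        rfl
      change 0 ≤ (⟪x, φ (ι f.toContinuousMap) x⟫_ℂ).re
      rw [h1, map_mul, map_star, mul_apply_eq_comp, ContinuousLinearMap.star_eq_adjoint,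
        ContinuousLinearMap.adjoint_inner_right]
      exact inner_self_nonneg (𝕜 := ℂ)
  have hΛ : ∀ f : C(X, ℝ), ∫ z, f z ∂(RealRMK.rieszMeasure Λ) = (⟪x, φ (ι f) x⟫_ℂ).re :=
    fun f => RealRMK.integral_rieszMeasure Λ
      ⟨f, HasCompactSupport.of_compactSpace _⟩
  refine ⟨RealRMK.rieszMeasure Λ, inferInstance, fun f => ?_⟩
  let f₁ : C(X, ℝ) := ⟨fun z => (f z).re, by fun_prop⟩
  let f₂ : C(X, ℝ) := ⟨fun z => (f z).im, by fun_prop⟩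
  have hf : f = ι f₁ + Complex.I • ι f₂ := by
    ext z
    simp [ι, f₁, f₂, mul_comm Complex.I]
  have hint : Integrable f (RealRMK.rieszMeasure Λ) :=
    f.continuous.integrable_of_hasCompactSupport (HasCompactSupport.of_compactSpace _)
  rw [← integral_re_add_im hint]
  have e1 : ⟪x, φ (ι f₁) x⟫_ℂ = ((∫ z, f₁ z ∂(RealRMK.rieszMeasure Λ) : ℝ) : ℂ) := by
    rw [hΛ, hreal]
  have e2 : ⟪x, φ (ι f₂) x⟫_ℂ = ((∫ z, f₂ z ∂(RealRMK.rieszMeasure Λ) : ℝ) : ℂ) := by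
    rw [hΛ, hreal]
  conv_rhs => rw [hf, map_add, map_smul, add_apply, smul_apply, inner_add_right, inner_smul_right,
    e1, e2, mul_comm]
  rfl

theorem isSelfAdjoint_of_quadratic_real {A : H →L[ℂ] H} (h : ∀ x, ∃ r : ℝ, ⟪x, A x⟫_ℂ = r) :
    IsSelfAdjoint A := by
  rw [ContinuousLinearMap.isSelfAdjoint_iff']
  refine ext_quadratic fun x => ?_
  obtain ⟨r, hr⟩ := h x
  rw [ContinuousLinearMap.adjoint_inner_right, ← inner_conj_symm, hr, Complex.conj_ofReal]

theorem inner_eq_norm_sq_of_idempotent {P : H →L[ℂ] H} (hP : IsSelfAdjoint P) (hPP : P * P = P)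
    (x : H) : ⟪x, P x⟫_ℂ = ((‖P x‖ ^ 2 : ℝ) : ℂ) := by
  have h1 : P (P x) = P x := congrArg (fun D : H →L[ℂ] H => D x) hPP
  have h2 := ContinuousLinearMap.adjoint_inner_left P (P x) x
  rw [ContinuousLinearMap.isSelfAdjoint_iff'.mp hP, h1] at h2
  rw [← h2, inner_self_eq_norm_sq_to_K]
  push_cast
  rfl

theorem mul_eq_zero_of_quadratic_le {H : Type*} [NormedAddCommGroup H] [InnerProductSpace ℂ H]
    {P Q : H →L[ℂ] H} (hPP : P * P = P)
    (h : ∀ x, ‖P x‖ ^ 2 + ‖Q x‖ ^ 2 ≤ ‖x‖ ^ 2) : Q * P = 0 := by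
  ext x
  have h1 : P (P x) = P x := congrArg (fun D : H →L[ℂ] H => D x) hPP
  have h2 := h (P x)
  rw [h1] at h2
  have h3 : ‖Q (P x)‖ ^ 2 ≤ 0 := by linarith
  have h4 : ‖Q (P x)‖ = 0 := by nlinarith [norm_nonneg (Q (P x))]
  simpa using h4

theorem hasSum_measureReal {X : Type*} [MeasurableSpace X] (μ : Measure X) [IsFiniteMeasure μ]
    {Δ : ℕ → Set X} (hd : Pairwise (Function.onFun Disjoint Δ)) (hΔ : ∀ i, MeasurableSet (Δ i)) :
    HasSum (fun i => μ.real (Δ i)) (μ.real (⋃ i, Δ i)) := by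
  have h1 : ∑' i, μ (Δ i) = μ (⋃ i, Δ i) := (measure_iUnion hd hΔ).symm
  have h2 : ∑' i, μ (Δ i) ≠ ⊤ := h1 ▸ measure_ne_top μ _
  have h3 := ENNReal.hasSum_toReal h2
  rwa [← ENNReal.tsum_toReal_eq (fun i => measure_ne_top μ _), h1] at h3

/-- The bounded Borel functions `1_Δ` can be inserted in a continuous functional calculus. -/
theorem exists_proj_of_starAlgHom {X : Type*} [TopologicalSpace X] [CompactSpace X] [T2Space X]
    [MeasurableSpace X] [BorelSpace X] [HasOuterApproxClosed X]
    (φ : C(X, ℂ) →⋆ₐ[ℂ] (H →L[ℂ] H)) (μ : H → Measure X) [∀ x, IsFiniteMeasure (μ x)]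
    (hμ : ∀ x (f : C(X, ℂ)), ∫ z, f z ∂(μ x) = ⟪x, φ f x⟫_ℂ) (Δ : Set X) (hΔ : MeasurableSet Δ) :
    ∃ P : H →L[ℂ] H, P * P = P ∧ ∀ x, ⟪x, P x⟫_ℂ = ((μ x).real Δ : ℂ) := by
  have huniv : ∀ x, (μ x).real Set.univ = ‖x‖ ^ 2 := fun x => by
    have h1 := hμ x 1
    have h2 := inner_self_eq_norm_sq_to_K (𝕜 := ℂ) x
    simp only [ContinuousMap.one_apply, integral_const, map_one, one_apply_eq_self, h2,
      Complex.real_smul, mul_one] at h1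
    apply Complex.ofReal_injective
    rw [Complex.ofReal_pow]
    exact h1
  have hsa : ∀ {P : H →L[ℂ] H} {Δ : Set X}, (∀ x, ⟪x, P x⟫_ℂ = ((μ x).real Δ : ℂ)) →
      IsSelfAdjoint P := fun h => isSelfAdjoint_of_quadratic_real fun x => ⟨_, h x⟩
  refine MeasurableSpace.induction_on_inter (C := fun Δ _ => ∃ P : H →L[ℂ] H, P * P = P ∧
      ∀ x, ⟪x, P x⟫_ℂ = ((μ x).real Δ : ℂ))
    (BorelSpace.measurable_eq.trans borel_eq_generateFrom_isClosed) isPiSystem_isClosed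
    ?_ ?_ ?_ ?_ Δ hΔ
  · exact ⟨0, by simp, fun x => by simp⟩
  · intro F hF
    have hF' : IsClosed F := by simpa using hF
    let g : ℕ → C(X, ℂ) := fun n => ⟨fun z => ((hF'.apprSeq n z : ℝ) : ℂ), by fun_prop⟩
    have hg1 : ∀ n z, ‖g n z‖ ≤ 1 := fun n z => by
      have := HasOuterApproxClosed.apprSeq_apply_le_one hF' n z
      simpa [g] using this
    have hgF : ∀ n z, z ∈ F → g n z = 1 := fun n z hz => by
      simp [g, HasOuterApproxClosed.apprSeq_apply_eq_one hF' n hz]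
    have hglim : ∀ z, Filter.Tendsto (fun n => g n z) Filter.atTop
        (nhds (F.indicator (fun _ => (1 : ℂ)) z)) := fun z => by
      have h1 := (tendsto_pi_nhds.mp (HasOuterApproxClosed.tendsto_apprSeq hF')) z
      have h2 : Continuous (fun r : NNReal => ((r : ℝ) : ℂ)) := by fun_prop
      have h3 := (h2.tendsto _).comp h1
      have e : (((F.indicator (fun _ => (1 : NNReal)) z : NNReal) : ℝ) : ℂ)
          = F.indicator (fun _ => (1 : ℂ)) z := by
        by_cases hz : z ∈ F <;> simp [hz]
      rw [← e]
      exact h3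
    have hlim : ∀ x, Filter.Tendsto (fun n => ⟪x, φ (g n) x⟫_ℂ) Filter.atTop
        (nhds ((μ x).real F : ℂ)) := fun x => by
      simp only [← hμ]
      have e : ((μ x).real F : ℂ) = ∫ z, F.indicator (fun _ => (1 : ℂ)) z ∂(μ x) := by
        rw [integral_indicator hF'.measurableSet]
        simp
      rw [e]
      exact tendsto_integral_of_dominated_convergence (fun _ => 1)
        (fun n => (g n).continuous.aestronglyMeasurable) (integrable_const _)
        (fun n => Filter.Eventually.of_forall (hg1 n)) (Filter.Eventually.of_forall hglim)
    have hlim2 : ∀ m x, Filter.Tendsto (fun n => ⟪x, φ (g n) (φ (g m) x)⟫_ℂ) Filter.atTop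
        (nhds ((μ x).real F : ℂ)) := fun m x => by
      have e0 : ∀ n, ⟪x, φ (g n) (φ (g m) x)⟫_ℂ = ∫ z, (g n * g m) z ∂(μ x) := fun n => by
        rw [hμ, map_mul]
        rfl
      simp only [e0]
      have e : ((μ x).real F : ℂ) = ∫ z, F.indicator (fun _ => (1 : ℂ)) z ∂(μ x) := by
        rw [integral_indicator hF'.measurableSet]
        simp
      rw [e]
      refine tendsto_integral_of_dominated_convergence (fun _ => 1)
        (fun n => (g n * g m).continuous.aestronglyMeasurable) (integrable_const _)
        (fun n => Filter.Eventually.of_forall fun z => ?_)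
        (Filter.Eventually.of_forall fun z => ?_)
      · rw [ContinuousMap.mul_apply, norm_mul]
        exact mul_le_one₀ (hg1 n z) (norm_nonneg _) (hg1 m z)
      · have := (hglim z).mul_const (g m z)
        by_cases hz : z ∈ F
        · simpa [hz, hgF] using this
        · simp [hz] at this ⊢
          exact this
    obtain ⟨P, hP⟩ := exists_tendsto_weakly (fun n => φ (g n)) _ hlim
    have hq : ∀ x, ⟪x, P x⟫_ℂ = ((μ x).real F : ℂ) := fun x =>
      tendsto_nhds_unique (hP x x) (hlim x)
    have hPg : ∀ m, P * φ (g m) = P := fun m => ext_quadratic fun x => by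
      rw [mul_apply_eq_comp, hq]
      exact tendsto_nhds_unique (hP x (φ (g m) x)) (hlim2 m x)
    refine ⟨P, ext_quadratic fun x => ?_, hq⟩
    have h1 := hP (ContinuousLinearMap.adjoint P x) x
    simp only [ContinuousLinearMap.adjoint_inner_left, ← mul_apply_eq_comp, hPg] at h1
    exact (tendsto_nhds_unique h1 tendsto_const_nhds)
  · intro Δ hΔ ih
    obtain ⟨P, hPP, hP⟩ := ih
    refine ⟨1 - P, by simp [sub_mul, mul_sub, hPP], fun x => ?_⟩
    rw [measureReal_compl hΔ, sub_apply, one_apply_eq_self, inner_sub_right, hP, huniv,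
      inner_self_eq_norm_sq_to_K]
    push_cast
    rfl
  · intro Δ hd hΔ ih
    choose P hPP hP using ih
    have hnorm : ∀ i x, ‖P i x‖ ^ 2 = (μ x).real (Δ i) := fun i x => by
      have := inner_eq_norm_sq_of_idempotent (hsa (hP i)) (hPP i) x
      rw [hP] at this
      exact_mod_cast this.symm
    have horth : ∀ i j, i ≠ j → P i * P j = 0 := fun i j hij =>
      mul_eq_zero_of_quadratic_le (hPP j) fun x => by
        rw [hnorm, hnorm, ← huniv, ← measureReal_union (hd hij.symm) (hΔ i)]
        exact measureReal_mono (Set.subset_univ _)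
    have hlim : ∀ x, Filter.Tendsto (fun n => ⟪x, (∑ i ∈ Finset.range n, P i) x⟫_ℂ) Filter.atTop
        (nhds ((μ x).real (⋃ i, Δ i) : ℂ)) := fun x => by
      have h1 : HasSum (fun i => (μ x).real (Δ i)) ((μ x).real (⋃ i, Δ i)) :=
        hasSum_measureReal _ hd hΔ
      have h2 := (Complex.hasSum_ofReal.mpr h1).tendsto_sum_nat
      simpa only [sum_apply, inner_sum, hP] using h2
    obtain ⟨Q, hQ⟩ := exists_tendsto_weakly (fun n => ∑ i ∈ Finset.range n, P i) _ hlim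
    have hPQ : ∀ i, P i * Q = P i := fun i => ext_quadratic fun x => by
      have h1 := hQ (ContinuousLinearMap.adjoint (P i) x) x
      simp only [ContinuousLinearMap.adjoint_inner_left] at h1
      refine tendsto_nhds_unique h1 (tendsto_const_nhds.congr' ?_)
      filter_upwards [Filter.eventually_gt_atTop i] with n hn
      rw [← mul_apply_eq_comp, Finset.mul_sum, Finset.sum_eq_single i
        (fun j _ hj => horth i j hj.symm) (fun h => absurd (Finset.mem_range.mpr hn) h), hPP]
    refine ⟨Q, ext_quadratic fun x => ?_, fun x => tendsto_nhds_unique (hQ x x) (hlim x)⟩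
    have h1 := hQ x (Q x)
    simp only [← mul_apply_eq_comp, Finset.sum_mul, hPQ] at h1
    exact tendsto_nhds_unique h1 (hQ x x)

/-- The spectral theorem for bounded normal operators. -/
theorem exists_isSpectralMeasureOf (A : H →L[ℂ] H) (hA : IsStarNormal A) :
    ∃ E : SpectralMeasure H, E.IsSpectralMeasureOf A := by
  let X := spectrum ℂ A
  have : CompactSpace X := isCompact_iff_compactSpace.mp (spectrum.isCompact A)
  let φ : C(X, ℂ) →⋆ₐ[ℂ] (H →L[ℂ] H) := cfcHom hA
  choose μ hfin hμ using exists_measure_of_starAlgHom φ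
  choose P hPP hP using fun (Δ : Set X) (hΔ : MeasurableSet Δ) =>
    exists_proj_of_starAlgHom φ μ hμ Δ hΔ
  have hsa : ∀ Δ hΔ, IsSelfAdjoint (P Δ hΔ) := fun Δ hΔ =>
    isSelfAdjoint_of_quadratic_real fun x => ⟨_, hP Δ hΔ x⟩
  have hnorm : ∀ Δ hΔ x, ‖P Δ hΔ x‖ ^ 2 = (μ x).real Δ := fun Δ hΔ x => by
    have := inner_eq_norm_sq_of_idempotent (hsa Δ hΔ) (hPP Δ hΔ) x
    rw [hP] at this
    exact_mod_cast this.symm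
  have huniv : P Set.univ .univ = 1 := ext_quadratic fun x => by
    have h1 := hμ x 1
    simp only [ContinuousMap.one_apply, integral_const, map_one, one_apply_eq_self,
      Complex.real_smul, mul_one] at h1
    rw [hP, h1, one_apply_eq_self]
  have hadd : ∀ Δ₁ h₁ Δ₂ h₂, Disjoint Δ₁ Δ₂ →
      P (Δ₁ ∪ Δ₂) (MeasurableSet.union h₁ h₂) = P Δ₁ h₁ + P Δ₂ h₂ := fun Δ₁ h₁ Δ₂ h₂ hd =>
    ext_quadratic fun x => by
      rw [hP, add_apply, inner_add_right, hP, hP, measureReal_union hd h₂]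
      push_cast
      rfl
  have horth : ∀ Δ₁ h₁ Δ₂ h₂, Disjoint Δ₁ Δ₂ → P Δ₁ h₁ * P Δ₂ h₂ = 0 := fun Δ₁ h₁ Δ₂ h₂ hd =>
    mul_eq_zero_of_quadratic_le (hPP Δ₂ h₂) fun x => by
      have e : ‖x‖ ^ 2 = (μ x).real Set.univ := by
        rw [← hnorm Set.univ .univ x, huniv, one_apply_eq_self]
      rw [hnorm, hnorm, e, ← measureReal_union hd.symm h₁]
      exact measureReal_mono (Set.subset_univ _)
  have hinter : ∀ Δ₁ h₁ Δ₂ h₂, P (Δ₁ ∩ Δ₂) (MeasurableSet.inter h₁ h₂) = P Δ₁ h₁ * P Δ₂ h₂ :=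
    fun Δ₁ h₁ Δ₂ h₂ => by
      have e₁ : P Δ₁ h₁ = P (Δ₁ ∩ Δ₂) (h₁.inter h₂) + P (Δ₁ \ Δ₂) (h₁.diff h₂) := by
        rw [← hadd _ _ _ _ Set.disjoint_sdiff_inter.symm]
        congr 1
        exact (Set.inter_union_sdiff Δ₁ Δ₂).symm
      have e₂ : P Δ₂ h₂ = P (Δ₁ ∩ Δ₂) (h₁.inter h₂) + P (Δ₂ \ Δ₁) (h₂.diff h₁) := by
        rw [← hadd _ _ _ _ (by rw [Set.inter_comm]; exact Set.disjoint_sdiff_inter.symm)]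
        congr 1
        rw [Set.inter_comm]
        exact (Set.inter_union_sdiff Δ₂ Δ₁).symm
      rw [e₁, e₂, mul_add, add_mul, add_mul, hPP, horth _ _ (Δ₁ ∩ Δ₂), horth (Δ₁ ∩ Δ₂),
        horth (Δ₁ \ Δ₂)]
      · simp
      · exact disjoint_sdiff_sdiff
      · exact Set.disjoint_left.mpr fun z hz hz' => hz'.2 hz.1
      · exact Set.disjoint_left.mpr fun z hz hz' => hz.2 hz'.2
  have hval : Measurable (Subtype.val : X → ℂ) := measurable_subtype_coe
  classical
  let E : SpectralMeasure H :=
    { proj := fun Δ => if hΔ : MeasurableSet Δ then P (Subtype.val ⁻¹' Δ) (hval hΔ) else 0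
      isStarProjection := fun Δ hΔ => by
        rw [dif_pos hΔ]
        exact ⟨hPP _ _, hsa _ _⟩
      proj_univ := by
        rw [dif_pos .univ]
        exact huniv
      proj_inter := fun Δ₁ Δ₂ h₁ h₂ => by
        rw [dif_pos h₁, dif_pos h₂, dif_pos (h₁.inter h₂)]
        exact hinter _ _ _ _
      proj_iUnion := fun Δ hΔ hd x => by
        have e : ∀ n, (if hΔ : MeasurableSet (Δ n) then P (Subtype.val ⁻¹' Δ n) (hval hΔ) else 0)
            = P (Subtype.val ⁻¹' Δ n) (hval (hΔ n)) := fun n => dif_pos (hΔ n)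
        have hU : MeasurableSet (⋃ n, Δ n) := .iUnion hΔ
        simp only [e]
        rw [dif_pos hU]
        have hd' : Pairwise (Function.onFun Disjoint fun n => (Subtype.val ⁻¹' Δ n : Set X)) :=
          fun i j hij => (hd hij).preimage _
        have hs : HasSum (fun n => (μ x).real (Subtype.val ⁻¹' Δ n))
            ((μ x).real (Subtype.val ⁻¹' ⋃ n, Δ n)) := by
          rw [Set.preimage_iUnion]
          exact hasSum_measureReal _ hd' fun i => hval (hΔ i)
        have hsq : ∀ s : Finset ℕ, ‖(∑ n ∈ s, P (Subtype.val ⁻¹' Δ n) (hval (hΔ n)) x)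
            - P (Subtype.val ⁻¹' ⋃ n, Δ n) (hval hU) x‖ ^ 2
            = (μ x).real (Subtype.val ⁻¹' ⋃ n, Δ n)
              - ∑ n ∈ s, (μ x).real (Subtype.val ⁻¹' Δ n) := fun s => by
          have hD : MeasurableSet (⋃ n ∈ s, (Subtype.val ⁻¹' Δ n : Set X)) :=
            Finset.measurableSet_biUnion s fun n _ => hval (hΔ n)
          have hDU : (⋃ n ∈ s, (Subtype.val ⁻¹' Δ n : Set X)) ⊆ Subtype.val ⁻¹' ⋃ n, Δ n := by
            rw [Set.preimage_iUnion]
            exact Set.iUnion₂_subset_iUnion _ _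
          have hm : (μ x).real (⋃ n ∈ s, (Subtype.val ⁻¹' Δ n : Set X))
              = ∑ n ∈ s, (μ x).real (Subtype.val ⁻¹' Δ n) :=
            measureReal_biUnion_finset (fun i _ j _ hij => hd' hij) fun n _ => hval (hΔ n)
          have e₁ : ∑ n ∈ s, P (Subtype.val ⁻¹' Δ n) (hval (hΔ n)) = P _ hD :=
            ext_quadratic fun y => by
              rw [hP, sum_apply, inner_sum, measureReal_biUnion_finset
                (fun i _ j _ hij => hd' hij) fun n _ => hval (hΔ n)]
              simp only [hP]
              push_cast
              rfl
          have e₂ : P (Subtype.val ⁻¹' ⋃ n, Δ n) (hval hU)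
              = P _ hD + P _ ((hval hU).diff hD) := by
            rw [← hadd _ _ _ _ Set.disjoint_sdiff_right]
            congr 1
            exact (Set.union_sdiff_cancel hDU).symm
          rw [← sum_apply, e₁, e₂, add_apply, sub_add_cancel_left, norm_neg, hnorm, ← hm,
            measureReal_sdiff hDU hD]
        rw [HasSum, tendsto_iff_norm_sub_tendsto_zero]
        have h0 : Filter.Tendsto (fun s : Finset ℕ =>
            ‖(∑ n ∈ s, P (Subtype.val ⁻¹' Δ n) (hval (hΔ n)) x)
              - P (Subtype.val ⁻¹' ⋃ n, Δ n) (hval hU) x‖ ^ 2)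
            (SummationFilter.unconditional ℕ).filter (nhds 0) := by
          simp only [hsq]
          simpa using (tendsto_const_nhds (x := (μ x).real (Subtype.val ⁻¹' ⋃ n, Δ n))).sub hs
        have h1 := (Real.continuous_sqrt.tendsto _).comp h0
        simpa [Function.comp_def, Real.sqrt_sq] using h1 }
  have hE : ∀ Δ, (hΔ : MeasurableSet Δ) → E Δ = P (Subtype.val ⁻¹' Δ) (hval hΔ) := fun Δ hΔ =>
    dif_pos hΔ
  have hσ : MeasurableSet (spectrum ℂ A) := (spectrum.isClosed A).measurableSet
  have hscalar : ∀ x, E.scalarMeasure x = (μ x).map Subtype.val := fun x => by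
    ext Δ hΔ
    rw [E.scalarMeasure_apply x hΔ, hE Δ hΔ, hnorm, Measure.map_apply hval hΔ, Measure.real,
      ENNReal.ofReal_toReal (measure_ne_top _ _)]
  refine ⟨E, ?_, ext_quadratic fun x => ?_⟩
  · rw [hE _ hσ.compl]
    refine ext_quadratic fun x => ?_
    rw [hP]
    have : (Subtype.val ⁻¹' (spectrum ℂ A)ᶜ : Set X) = ∅ := by
      ext z
      simpa using z.2
    simp [this]
  · have hmeas : Measurable ((spectrum ℂ A).indicator fun z : ℂ => z) :=
      measurable_id.indicator hσ
    rw [SpectralMeasure.integralOn, E.inner_integral hmeas, hscalar,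
      integral_map hval.aemeasurable hmeas.aestronglyMeasurable]
    · have h1 := hμ x ((ContinuousMap.id ℂ).restrict (spectrum ℂ A))
      have h2 : φ ((ContinuousMap.id ℂ).restrict (spectrum ℂ A)) = A := cfcHom_id hA
      rw [h2] at h1
      rw [← h1]
      refine integral_congr_ae (Filter.Eventually.of_forall fun z => ?_)
      exact Set.indicator_of_mem z.2 _
    · refine ⟨‖A‖ * ‖(1 : H →L[ℂ] H)‖, fun z => ?_⟩
      by_cases hz : z ∈ spectrum ℂ A
      · rw [Set.indicator_of_mem hz]
        exact spectrum.norm_le_norm_mul_of_mem hz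
      · rw [Set.indicator_of_notMem hz, norm_zero]
        positivity

/-- The spectral measure of a normal operator. -/
def spectralMeasure (A : H →L[ℂ] H) (hA : IsStarNormal A) : SpectralMeasure H :=
  (exists_isSpectralMeasureOf A hA).choose

theorem isSpectralMeasureOf_spectralMeasure (A : H →L[ℂ] H) (hA : IsStarNormal A) :
    (spectralMeasure A hA).IsSpectralMeasureOf A :=
  (exists_isSpectralMeasureOf A hA).choose_spec

end SpectralTheorem
end

/-!
Write `S` for `T_j` and `R` for `R_j`. Since `S = T R`, the operator `Θ(N)` commutes with `R R⁺` and
`Γ_j(Θ(N)) = Θ_j(N)`, so that `R` intertwines `Θ_j(N)` with `Θ(N)` and also `Θ_j(N)⁺` with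
`Θ(N)⁺`. The bounded measurable functions `f` with `R ∫ f dE_j = (∫ f dE) R` are closed under sums,
products and bounded pointwise limits. They contain `z` and `z̄`, hence all continuous functions by
the Stone–Weierstrass theorem, and therefore all bounded measurable functions. Applied to a
self-adjoint operator in place of `R`, the same argument shows that the integrals lie in the
required commutants.
-/

section BoundedMeasurable

open Filter

variable {α : Type*} [MeasurableSpace α] {f g : α → ℂ} {u : ℕ → α → ℂ}

/-- Bounded measurable complex-valued functions, the functions which can be integrated against a
spectral measure. -/
structure IsBoundedMeasurable (f : α → ℂ) : Prop where
  measurable : Measurable f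
  exists_bound : ∃ M, ∀ z, ‖f z‖ ≤ M

/-- Bounded pointwise convergence of a sequence of measurable functions, the mode of convergence
of the dominated convergence theorem for arbitrary finite measures. -/
structure BoundedPointwiseTendsto (u : ℕ → α → ℂ) (f : α → ℂ) : Prop where
  measurable : ∀ n, Measurable (u n)
  exists_bound : ∃ M, ∀ n z, ‖u n z‖ ≤ M
  tendsto : ∀ z, Tendsto (u · z) atTop (nhds (f z))

theorem norm_extend_coe_zero_le {α : Type*} {S : Set α} {f : S → ℂ} {M : ℝ} (hM : ∀ z, ‖f z‖ ≤ M)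
    (z : α) : ‖Function.extend Subtype.val f 0 z‖ ≤ max M 0 := by
  by_cases hz : z ∈ S
  · exact (Subtype.val_injective.extend_apply f 0 ⟨z, hz⟩).symm ▸ le_max_of_le_left (hM _)
  · simp [Function.extend_apply', hz]

theorem extend_coe_domRestrict_zero {α : Type*} (S : Set α) (f : α → ℂ) :
    Function.extend Subtype.val (S.domRestrict f) 0 = S.indicator f := by
  ext z
  by_cases hz : z ∈ S
  · exact (Subtype.val_injective.extend_apply (S.domRestrict f) 0 ⟨z, hz⟩).trans
      (Set.indicator_of_mem hz f).symm
  · simp [Function.extend_apply', hz]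

namespace IsBoundedMeasurable

theorem const (c : ℂ) : IsBoundedMeasurable fun _ : α => c :=
  ⟨measurable_const, ‖c‖, fun _ => le_rfl⟩

theorem indicator (hf : IsBoundedMeasurable f) {S : Set α} (hS : MeasurableSet S) :
    IsBoundedMeasurable (S.indicator f) :=
  ⟨hf.measurable.indicator hS, hf.exists_bound.imp fun _ hM z =>
    (norm_indicator_le_norm_self f z).trans (hM z)⟩

theorem add (hf : IsBoundedMeasurable f) (hg : IsBoundedMeasurable g) :
    IsBoundedMeasurable (f + g) := by
  obtain ⟨M, hM⟩ := hf.exists_bound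
  obtain ⟨L, hL⟩ := hg.exists_bound
  exact ⟨hf.measurable.add hg.measurable, M + L, fun z => norm_add_le_of_le (hM z) (hL z)⟩

theorem mul (hf : IsBoundedMeasurable f) (hg : IsBoundedMeasurable g) :
    IsBoundedMeasurable (f * g) := by
  obtain ⟨M, hM⟩ := hf.exists_bound
  obtain ⟨L, hL⟩ := hg.exists_bound
  exact ⟨hf.measurable.mul hg.measurable, M * L, fun z => norm_mul_le_of_le (hM z) (hL z)⟩

theorem smul (c : ℂ) (hf : IsBoundedMeasurable f) : IsBoundedMeasurable (c • f) :=
  (const c).mul hf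

protected theorem star (hf : IsBoundedMeasurable f) : IsBoundedMeasurable (star f) :=
  ⟨continuous_star.measurable.comp hf.measurable, by simpa using hf.exists_bound⟩

theorem of_continuous [TopologicalSpace α] [CompactSpace α] [OpensMeasurableSpace α]
    (hf : Continuous f) : IsBoundedMeasurable f :=
  ⟨hf.measurable, ‖(⟨f, hf⟩ : C(α, ℂ))‖, ContinuousMap.norm_coe_le_norm ⟨f, hf⟩⟩

theorem comp_coe (hf : IsBoundedMeasurable f) (S : Set α) :
    IsBoundedMeasurable fun z : S => f z :=
  ⟨hf.measurable.comp measurable_subtype_coe, hf.exists_bound.imp fun _ hM z => hM z⟩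

theorem extend {S : Set α} (hS : MeasurableSet S) {f : S → ℂ} (hf : IsBoundedMeasurable f) :
    IsBoundedMeasurable (Function.extend Subtype.val f 0) :=
  ⟨(MeasurableEmbedding.subtype_coe hS).measurable_extend hf.measurable measurable_const,
    hf.exists_bound.elim fun M hM => ⟨max M 0, norm_extend_coe_zero_le hM⟩⟩

theorem indicator_of_domRestrict {S : Set α} (hS : MeasurableSet S)
    (hm : Measurable (S.domRestrict f)) (hb : ∃ M, ∀ z ∈ S, ‖f z‖ ≤ M) :
    IsBoundedMeasurable (S.indicator f) :=
  extend_coe_domRestrict_zero S f ▸ extend hS ⟨hm, hb.imp fun _ hM z => hM z z.2⟩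

theorem indicator_id {s : Set ℂ} (hs : IsCompact s) : IsBoundedMeasurable (s.indicator id) :=
  indicator_of_domRestrict hs.measurableSet measurable_subtype_coe hs.isBounded.exists_norm_le

theorem integrable (hf : IsBoundedMeasurable f) (μ : Measure α) [IsFiniteMeasure μ] :
    Integrable f μ :=
  hf.exists_bound.elim fun M hM =>
    .of_bound hf.measurable.aestronglyMeasurable M (.of_forall hM)

end IsBoundedMeasurable

namespace BoundedPointwiseTendsto

theorem isBoundedMeasurable_seq (hu : BoundedPointwiseTendsto u f) (n : ℕ) :
    IsBoundedMeasurable (u n) :=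
  ⟨hu.measurable n, hu.exists_bound.imp fun _ hM => hM n⟩

theorem isBoundedMeasurable (hu : BoundedPointwiseTendsto u f) : IsBoundedMeasurable f :=
  ⟨measurable_of_tendsto_metrizable hu.measurable (tendsto_pi_nhds.mpr hu.tendsto),
    hu.exists_bound.imp fun _ hM z =>
      le_of_tendsto (hu.tendsto z).norm (.of_forall fun n => hM n z)⟩

theorem mul_const (hu : BoundedPointwiseTendsto u f) (hg : IsBoundedMeasurable g) :
    BoundedPointwiseTendsto (fun n => u n * g) (f * g) where
  measurable n := (hu.measurable n).mul hg.measurable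
  exists_bound := by
    obtain ⟨M, hM⟩ := hu.exists_bound
    obtain ⟨L, hL⟩ := hg.exists_bound
    exact ⟨M * L, fun n z => norm_mul_le_of_le (hM n z) (hL z)⟩
  tendsto z := (hu.tendsto z).mul_const (g z)

theorem extend {S : Set α} (hS : MeasurableSet S) {u : ℕ → S → ℂ} {f : S → ℂ}
    (hu : BoundedPointwiseTendsto u f) :
    BoundedPointwiseTendsto (fun n => Function.extend Subtype.val (u n) 0)
      (Function.extend Subtype.val f 0) where
  measurable n := ((hu.isBoundedMeasurable_seq n).extend hS).measurable
  exists_bound := hu.exists_bound.elim fun M hM =>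
    ⟨max M 0, fun n => norm_extend_coe_zero_le (hM n)⟩
  tendsto z := by
    by_cases hz : z ∈ S
    · have hval (v : S → ℂ) := Subtype.val_injective.extend_apply v 0 ⟨z, hz⟩
      simpa only [hval] using hu.tendsto ⟨z, hz⟩
    · simp [Function.extend_apply', hz]

theorem of_tendsto_continuousMap [TopologicalSpace α] [CompactSpace α] [OpensMeasurableSpace α]
    {u : ℕ → C(α, ℂ)} {f : C(α, ℂ)} (hu : Tendsto u atTop (nhds f)) :
    BoundedPointwiseTendsto (fun n => ⇑(u n)) f where
  measurable n := (u n).continuous.measurable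
  exists_bound := by
    obtain ⟨M, hM⟩ := hu.norm.bddAbove_range
    exact ⟨M, fun n z => ((u n).norm_coe_le_norm z).trans (hM ⟨n, rfl⟩)⟩
  tendsto z := ((continuous_eval_const z).tendsto f).comp hu

end BoundedPointwiseTendsto

theorem IsBoundedMeasurable.induction {P : (α → ℂ) → Prop}
    (indicator_const : ∀ (c : ℂ) {Δ : Set α}, MeasurableSet Δ → P (Δ.indicator fun _ => c))
    (add : ∀ {f g}, IsBoundedMeasurable f → IsBoundedMeasurable g → P f → P g → P (f + g))
    (limit : ∀ {u f}, BoundedPointwiseTendsto u f → (∀ n, P (u n)) → P f)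
    (hf : IsBoundedMeasurable f) : P f := by
  have simpleFunc (s : SimpleFunc α ℂ) : P s := by
    induction s using SimpleFunc.induction with
    | const c hΔ => simpa using! indicator_const c hΔ
    | @add s t _ hs ht =>
      exact add ⟨s.measurable, s.exists_forall_norm_le⟩
        ⟨t.measurable, t.exists_forall_norm_le⟩ hs ht
  obtain ⟨M, hM⟩ := hf.exists_bound
  have hsm : StronglyMeasurable f := hf.measurable.stronglyMeasurable
  exact limit (u := fun n => hsm.approxBounded (max M 0) n)
    { measurable := fun n => SimpleFunc.measurable _
      exists_bound := ⟨max M 0, hsm.norm_approxBounded_le (le_max_right M 0)⟩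
      tendsto := fun z => hsm.tendsto_approxBounded_of_norm_le (le_max_of_le_left (hM z)) }
    fun n => simpleFunc _

theorem biUnion_finset_indicator_of_disjoint {ι : Type*} {P : (α → ℂ) → Prop} (zero : P 0)
    (add : ∀ {f g}, IsBoundedMeasurable f → IsBoundedMeasurable g → P f → P g → P (f + g))
    {Δ : ι → Set α} (hd : Pairwise (Function.onFun Disjoint Δ)) (hΔ : ∀ i, MeasurableSet (Δ i))
    (hP : ∀ i, P ((Δ i).indicator fun _ => 1)) (t : Finset ι) :
    P ((⋃ i ∈ t, Δ i).indicator fun _ => 1) := by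
  classical
  induction t using Finset.induction_on with
  | empty => simpa using! zero
  | insert i t hi ih =>
    have hdisj : Disjoint (Δ i) (⋃ k ∈ t, Δ k) :=
      Set.disjoint_iUnion₂_right.mpr fun k hk => hd fun hik => hi (hik ▸ hk)
    rw [Finset.set_biUnion_insert, Set.indicator_union_of_disjoint hdisj]
    exact add ((IsBoundedMeasurable.const 1).indicator (hΔ i))
      ((IsBoundedMeasurable.const 1).indicator (t.measurableSet_biUnion fun k _ => hΔ k)) (hP i) ih

section Topology

variable [TopologicalSpace α] [BorelSpace α] [HasOuterApproxClosed α] {P : (α → ℂ) → Prop}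

theorem boundedPointwiseTendsto_apprSeq {F : Set α} (hF : IsClosed F) :
    BoundedPointwiseTendsto (fun n z => ((hF.apprSeq n z : ℝ) : ℂ))
      (F.indicator fun _ => 1) where
  measurable n := by fun_prop
  exists_bound := ⟨1, fun n z => by simpa using! HasOuterApproxClosed.apprSeq_apply_le_one hF n z⟩
  tendsto z := by
    have h := tendsto_pi_nhds.mp (HasOuterApproxClosed.tendsto_apprSeq hF) z
    have hcoe : Continuous fun r : NNReal => ((r : ℝ) : ℂ) := by fun_prop
    have h := (hcoe.tendsto _).comp h
    by_cases hz : z ∈ F <;> simpa [hz, Function.comp_def] using h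

theorem IsBoundedMeasurable.induction_on_continuous
    (continuous : ∀ f, Continuous f → IsBoundedMeasurable f → P f)
    (add : ∀ {f g}, IsBoundedMeasurable f → IsBoundedMeasurable g → P f → P g → P (f + g))
    (smul : ∀ {f} (c : ℂ), IsBoundedMeasurable f → P f → P (c • f))
    (limit : ∀ {u f}, BoundedPointwiseTendsto u f → (∀ n, P (u n)) → P f)
    (hf : IsBoundedMeasurable f) : P f := by
  have hbm {Δ : Set α} (hΔ : MeasurableSet Δ) : IsBoundedMeasurable (Δ.indicator fun _ => 1) :=
    (IsBoundedMeasurable.const 1).indicator hΔ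
  refine hf.induction (fun c Δ hΔ => ?_) add limit
  suffices hP : P (Δ.indicator fun _ => 1) by
    have heq : (Δ.indicator fun _ => c) = c • Δ.indicator fun _ => 1 :=
      funext fun z => by by_cases hz : z ∈ Δ <;> simp [hz]
    exact heq ▸ smul c (hbm hΔ) hP
  have hgen := ‹BorelSpace α›.measurable_eq.trans borel_eq_generateFrom_isClosed
  induction Δ, hΔ using MeasurableSpace.induction_on_inter hgen isPiSystem_isClosed with
  | empty => simpa using! continuous _ continuous_const (.const 0)
  | basic F hF =>
    have hlim := boundedPointwiseTendsto_apprSeq (show IsClosed F from hF)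
    exact limit hlim fun n => continuous _ (by fun_prop) (hlim.isBoundedMeasurable_seq n)
  | compl Δ hΔ ih =>
    have heq : Δᶜ.indicator (fun _ => 1) =
        (fun _ => 1) + (-1 : ℂ) • Δ.indicator (fun _ => (1 : ℂ)) := by
      rw [Set.indicator_compl, neg_one_smul, sub_eq_add_neg]
    rw [heq]
    exact add (.const 1) ((hbm hΔ).smul (-1)) (continuous _ continuous_const (.const 1))
      (smul _ (hbm hΔ) ih)
  | iUnion Δ hd hΔ ih =>
    have zero : P 0 := continuous _ continuous_const (.const 0)
    refine limit (u := fun n => (⋃ i ∈ Finset.range n, Δ i).indicator fun _ => 1)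
      { measurable := fun n => (hbm (Finset.measurableSet_biUnion _ fun k _ => hΔ k)).measurable
        exists_bound := ⟨1, fun n z => (norm_indicator_le_norm_self _ z).trans (by simp)⟩
        tendsto := fun z => ((tendsto_indicator_biUnion_finset Δ _ z).mono_right
          (pure_le_nhds _)).comp tendsto_finset_range }
      fun n => biUnion_finset_indicator_of_disjoint zero add hd hΔ ih _

end Topology

theorem IsBoundedMeasurable.induction_on_of_compact {s : Set ℂ} [CompactSpace s]
    {P : (s → ℂ) → Prop} {f : s → ℂ} (const : ∀ c, P fun _ => c) (id : P Subtype.val)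
    (star_id : P (star Subtype.val))
    (add : ∀ {f g}, IsBoundedMeasurable f → IsBoundedMeasurable g → P f → P g → P (f + g))
    (mul : ∀ {f g}, IsBoundedMeasurable f → IsBoundedMeasurable g → P f → P g → P (f * g))
    (limit : ∀ {u f}, BoundedPointwiseTendsto u f → (∀ n, P (u n)) → P f)
    (hf : IsBoundedMeasurable f) : P f := by
  have continuousMap (g : C(s, ℂ)) : P g := by
    induction g using ContinuousMap.induction_on_of_compact with
    | const c => exact const c
    | id => exact id
    | star_id => exact star_id
    | add g₁ g₂ h₁ h₂ =>
      exact add (.of_continuous g₁.continuous) (.of_continuous g₂.continuous) h₁ h₂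
    | mul g₁ g₂ h₁ h₂ =>
      exact mul (.of_continuous g₁.continuous) (.of_continuous g₂.continuous) h₁ h₂
    | frequently g hg =>
      obtain ⟨u, hu, hlim⟩ := mem_closure_iff_seq_limit.mp (mem_closure_iff_frequently.mpr hg)
      exact limit (.of_tendsto_continuousMap hlim) hu
  exact hf.induction_on_continuous (fun g hg _ => continuousMap ⟨g, hg⟩) add
    (fun c hg => mul (.const c) hg (const c)) limit

end BoundedMeasurable

namespace SpectralMeasure

section IntegralCalculus

variable {H : Type*} [NormedAddCommGroup H] [InnerProductSpace ℂ H] [CompleteSpace H]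
  (E : SpectralMeasure H) {f g : ℂ → ℂ} {u : ℕ → ℂ → ℂ} {Δ : Set ℂ}

theorem inner_proj_eq_measureReal (hΔ : MeasurableSet Δ) (x : H) :
    ⟪x, E Δ x⟫_ℂ = (E.scalarMeasure x).real Δ := by
  rw [E.inner_proj x hΔ, Measure.real, E.scalarMeasure_apply x hΔ,
    ENNReal.toReal_ofReal (sq_nonneg _), Complex.ofReal_pow]

theorem integral_eq_of_inner (hf : IsBoundedMeasurable f) {A : H →L[ℂ] H}
    (hA : ∀ x, ⟪x, A x⟫_ℂ = ∫ z, f z ∂(E.scalarMeasure x)) : E.integral f = A :=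
  ext_quadratic fun x => (E.inner_integral hf.measurable hf.exists_bound x).trans (hA x).symm

theorem integral_indicator_const (hΔ : MeasurableSet Δ) (c : ℂ) :
    E.integral (Δ.indicator fun _ => c) = c • E Δ :=
  E.integral_eq_of_inner ((IsBoundedMeasurable.const c).indicator hΔ) fun x => by
    rw [MeasureTheory.integral_indicator_const c hΔ, smul_apply, inner_smul_right,
      E.inner_proj_eq_measureReal hΔ, Complex.real_smul, mul_comm]

theorem integral_const (c : ℂ) : E.integral (fun _ => c) = c • 1 := by
  simpa only [Set.indicator_univ, E.proj_univ] using E.integral_indicator_const .univ c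

theorem integral_add (hf : IsBoundedMeasurable f) (hg : IsBoundedMeasurable g) :
    E.integral (f + g) = E.integral f + E.integral g :=
  E.integral_eq_of_inner (hf.add hg) fun x => by
    rw [add_apply, inner_add_right, E.inner_integral hf.measurable hf.exists_bound,
      E.inner_integral hg.measurable hg.exists_bound]
    exact (MeasureTheory.integral_add (hf.integrable _) (hg.integrable _)).symm

theorem integral_star (hf : IsBoundedMeasurable f) :
    E.integral (star f) = ContinuousLinearMap.adjoint (E.integral f) :=
  E.integral_eq_of_inner hf.star fun x => by
    rw [ContinuousLinearMap.adjoint_inner_right, ← inner_conj_symm,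
      E.inner_integral hf.measurable hf.exists_bound]
    exact integral_conj.symm

theorem integral_congr (hΔ : MeasurableSet Δ) (hE : E Δᶜ = 0) (hf : IsBoundedMeasurable f)
    (hg : IsBoundedMeasurable g) (hfg : Set.EqOn f g Δ) : E.integral f = E.integral g :=
  E.integral_eq_of_inner hf fun x => by
    have hnull : E.scalarMeasure x Δᶜ = 0 := by simp [E.scalarMeasure_apply x hΔ.compl, hE]
    rw [E.inner_integral hg.measurable hg.exists_bound]
    exact integral_congr_ae <| Filter.mem_of_superset (mem_ae_iff.mpr hnull) fun z hz =>
      (hfg hz).symm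

theorem tendsto_inner_integral (hu : BoundedPointwiseTendsto u f) (x y : H) :
    Filter.Tendsto (fun n => ⟪x, E.integral (u n) y⟫_ℂ) Filter.atTop
      (nhds ⟪x, E.integral f y⟫_ℂ) := by
  obtain ⟨M, hM⟩ := hu.exists_bound
  have hf := hu.isBoundedMeasurable
  have hquad (x : H) : Filter.Tendsto (fun n => ⟪x, E.integral (u n) x⟫_ℂ) Filter.atTop
      (nhds ⟪x, E.integral f x⟫_ℂ) := by
    simp only [E.inner_integral (hu.measurable _) ⟨M, hM _⟩,
      E.inner_integral hf.measurable hf.exists_bound]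
    exact tendsto_integral_of_dominated_convergence (fun _ => M)
      (fun n => (hu.measurable n).aestronglyMeasurable) (integrable_const _)
      (fun n => .of_forall (hM n)) (.of_forall hu.tendsto)
  obtain ⟨A, hA⟩ := exists_tendsto_weakly _ _ hquad
  rw [ext_quadratic fun x => tendsto_nhds_unique (hquad x) (hA x x)]
  exact hA x y

theorem integralOn_eq_integral (hΔ : MeasurableSet Δ) (hE : E Δᶜ = 0)
    (hf : IsBoundedMeasurable f) : E.integralOn Δ f = E.integral f :=
  E.integral_congr hΔ hE (hf.indicator hΔ) hf fun _ hz => Set.indicator_of_mem hz f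

theorem proj_compl_eq_zero_of_subset {S : Set ℂ} (hS : MeasurableSet S) (hΔ : MeasurableSet Δ)
    (hSΔ : S ⊆ Δ) (hE : E Sᶜ = 0) : E Δᶜ = 0 := by
  rw [← Set.inter_eq_left.mpr (Set.compl_subset_compl.mpr hSΔ),
    E.proj_inter _ _ hΔ.compl hS.compl, hE, mul_zero]

theorem integralOn_star_id {s : Set ℂ} (hs : IsCompact s) :
    E.integralOn s star = ContinuousLinearMap.adjoint (E.integralOn s id) := by
  rw [integralOn, integralOn, ← E.integral_star (.indicator_id hs)]
  congr 1
  ext z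
  by_cases hz : z ∈ s <;> simp [hz]

theorem integralOn_eq_integralOn_of_subset {S : Set ℂ} (hS : MeasurableSet S) (hSΔ : S ⊆ Δ)
    (hE : E Sᶜ = 0) (hf : IsBoundedMeasurable (Δ.indicator f)) :
    E.integralOn S f = E.integralOn Δ f := by
  simpa only [integralOn, Set.indicator_indicator, Set.inter_eq_left.mpr hSΔ] using
    E.integralOn_eq_integral hS hE hf

theorem IsSpectralMeasureOf.integralOn_id_of_subset {E : SpectralMeasure H} {A : H →L[ℂ] H}
    (hE : E.IsSpectralMeasureOf A) {s : Set ℂ} (hs : IsCompact s) (hAs : spectrum ℂ A ⊆ s) :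
    E.integralOn s id = A :=
  (E.integralOn_eq_integralOn_of_subset (spectrum.isClosed A).measurableSet hAs hE.1
    (.indicator_id hs)).symm.trans hE.2

end IntegralCalculus

section Comparison

variable {H₁ H₂ : Type*} [NormedAddCommGroup H₁] [InnerProductSpace ℂ H₁] [CompleteSpace H₁]
  [NormedAddCommGroup H₂] [InnerProductSpace ℂ H₂] [CompleteSpace H₂]
  {E₁ : SpectralMeasure H₁} {E₂ : SpectralMeasure H₂} {X Y : H₁ →L[ℂ] H₂}

theorem comp_integral_eq_integral_comp_of_tendsto {u₁ u₂ : ℕ → ℂ → ℂ} {f₁ f₂ : ℂ → ℂ}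
    (hu₁ : BoundedPointwiseTendsto u₁ f₁) (hu₂ : BoundedPointwiseTendsto u₂ f₂)
    (h : ∀ n, X ∘L E₁.integral (u₁ n) = E₂.integral (u₂ n) ∘L Y) :
    X ∘L E₁.integral f₁ = E₂.integral f₂ ∘L Y := by
  ext x
  refine ext_inner_left ℂ fun y => ?_
  have h₁ := E₁.tendsto_inner_integral hu₁ (ContinuousLinearMap.adjoint X y) x
  have h₂ := E₂.tendsto_inner_integral hu₂ y (Y x)
  simp only [ContinuousLinearMap.adjoint_inner_left, ← ContinuousLinearMap.comp_apply, h] at h₁ h₂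
  exact tendsto_nhds_unique h₁ h₂

end Comparison

section Multiplicativity

variable {H : Type*} [NormedAddCommGroup H] [InnerProductSpace ℂ H] [CompleteSpace H]
  (E : SpectralMeasure H) {f g : ℂ → ℂ}

theorem integral_indicator_const_mul {Δ : Set ℂ} (hΔ : MeasurableSet Δ) (c : ℂ)
    (hg : IsBoundedMeasurable g) :
    E.integral ((Δ.indicator fun _ => c) * g) = (c • E Δ) * E.integral g := by
  have hind := (IsBoundedMeasurable.const c).indicator hΔ
  let P (g : ℂ → ℂ) : Prop :=
    E.integral ((Δ.indicator fun _ => c) * g) = (c • E Δ) * E.integral g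
  refine hg.induction (P := P) (fun d Δ' hΔ' => ?_) (fun {f g} hf hg hPf hPg => ?_)
    fun {u f} hu hPu => ?_
  · have hprod : (Δ.indicator fun _ => c) * (Δ'.indicator fun _ => d) =
        (Δ ∩ Δ').indicator fun _ => c * d :=
      funext fun z => (Set.inter_indicator_mul _ _ z).symm
    simp only [P]
    rw [hprod, E.integral_indicator_const (hΔ.inter hΔ'), E.integral_indicator_const hΔ',
      E.proj_inter _ _ hΔ hΔ', smul_mul_smul_comm]
  · simp only [P] at hPf hPg ⊢
    rw [mul_add, E.integral_add (hind.mul hf) (hind.mul hg), hPf, hPg, E.integral_add hf hg,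
      mul_add]
  · simp only [P, mul_comm (Δ.indicator _)] at hPu ⊢
    exact (comp_integral_eq_integral_comp_of_tendsto (Y := 1) hu (hu.mul_const hind)
      fun n => (hPu n).symm).symm

theorem integral_mul (hf : IsBoundedMeasurable f) (hg : IsBoundedMeasurable g) :
    E.integral (f * g) = E.integral f * E.integral g := by
  let P (f : ℂ → ℂ) : Prop := E.integral (f * g) = E.integral f * E.integral g
  refine hf.induction (P := P) (fun c Δ hΔ => ?_) (fun {f₁ f₂} hf₁ hf₂ h₁ h₂ => ?_)
    fun hu hPu => comp_integral_eq_integral_comp_of_tendsto (X := 1) (hu.mul_const hg) hu hPu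
  · simp only [P]
    rw [E.integral_indicator_const_mul hΔ c hg, E.integral_indicator_const hΔ]
  · simp only [P] at h₁ h₂ ⊢
    rw [add_mul, E.integral_add (hf₁.mul hg) (hf₂.mul hg), h₁, h₂, E.integral_add hf₁ hf₂, add_mul]

end Multiplicativity

section Intertwining

variable {H₁ H₂ : Type*} [NormedAddCommGroup H₁] [InnerProductSpace ℂ H₁] [CompleteSpace H₁]
  [NormedAddCommGroup H₂] [InnerProductSpace ℂ H₂] [CompleteSpace H₂]
  {E₁ : SpectralMeasure H₁} {E₂ : SpectralMeasure H₂} {X : H₁ →L[ℂ] H₂} {f : ℂ → ℂ}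

theorem comp_integral_eq_integral_comp_of_isCompact {s : Set ℂ} (hs : IsCompact s)
    (h₁ : E₁ sᶜ = 0) (h₂ : E₂ sᶜ = 0)
    (hid : X ∘L E₁.integralOn s id = E₂.integralOn s id ∘L X)
    (hstar : X ∘L E₁.integralOn s star = E₂.integralOn s star ∘L X)
    (hf : IsBoundedMeasurable f) : X ∘L E₁.integral f = E₂.integral f ∘L X := by
  have hms : MeasurableSet s := hs.measurableSet
  have : CompactSpace s := isCompact_iff_compactSpace.mp hs
  let P (f : s → ℂ) : Prop := X ∘L E₁.integral (Function.extend Subtype.val f 0) =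
    E₂.integral (Function.extend Subtype.val f 0) ∘L X
  have hP {f : ℂ → ℂ} : P (s.domRestrict f) ↔ X ∘L E₁.integralOn s f = E₂.integralOn s f ∘L X := by
    simp only [P, extend_coe_domRestrict_zero, integralOn]
  rw [← E₁.integralOn_eq_integral hms h₁ hf, ← E₂.integralOn_eq_integral hms h₂ hf, ← hP]
  refine (hf.comp_coe s).induction_on_of_compact (P := P)
    (fun c => (hP (f := fun _ => c)).mpr ?_) (hP.mpr hid) (hP.mpr hstar)
    (fun {f g} hf hg hPf hPg => ?_) (fun {f g} hf hg hPf hPg => ?_)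
    fun {u f} hu hPu => comp_integral_eq_integral_comp_of_tendsto (hu.extend hms) (hu.extend hms)
      hPu
  · rw [E₁.integralOn_eq_integral hms h₁ (.const c), E₂.integralOn_eq_integral hms h₂ (.const c),
      integral_const, integral_const]
    ext x
    simp
  · have hadd := Function.extend_add (Subtype.val : s → ℂ) f g 0 0
    simp only [P, add_zero] at hadd hPf hPg ⊢
    rw [hadd, E₁.integral_add (hf.extend hms) (hg.extend hms),
      E₂.integral_add (hf.extend hms) (hg.extend hms), ContinuousLinearMap.comp_add, hPf, hPg,
      ContinuousLinearMap.add_comp]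
  · have hmul := Function.extend_mul (Subtype.val : s → ℂ) f g 0 0
    simp only [P, mul_zero] at hmul hPf hPg ⊢
    rw [hmul, E₁.integral_mul (hf.extend hms) (hg.extend hms),
      E₂.integral_mul (hf.extend hms) (hg.extend hms), ContinuousLinearMap.mul_def,
      ContinuousLinearMap.mul_def, ← ContinuousLinearMap.comp_assoc, hPf,
      ContinuousLinearMap.comp_assoc, hPg, ContinuousLinearMap.comp_assoc]

theorem IsSpectralMeasureOf.comp_integral_eq_integral_comp {B : H₁ →L[ℂ] H₁} {A : H₂ →L[ℂ] H₂}
    (hE₁ : E₁.IsSpectralMeasureOf B) (hE₂ : E₂.IsSpectralMeasureOf A) (hX : X ∘L B = A ∘L X)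
    (hX' : X ∘L ContinuousLinearMap.adjoint B = ContinuousLinearMap.adjoint A ∘L X)
    (hf : IsBoundedMeasurable f) : X ∘L E₁.integral f = E₂.integral f ∘L X := by
  have hs : IsCompact (spectrum ℂ B ∪ spectrum ℂ A) :=
    (spectrum.isCompact B).union (spectrum.isCompact A)
  have h₁ := hE₁.integralOn_id_of_subset hs Set.subset_union_left
  have h₂ := hE₂.integralOn_id_of_subset hs Set.subset_union_right
  refine comp_integral_eq_integral_comp_of_isCompact hs
    (E₁.proj_compl_eq_zero_of_subset (spectrum.isClosed B).measurableSet hs.measurableSet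
      Set.subset_union_left hE₁.1)
    (E₂.proj_compl_eq_zero_of_subset (spectrum.isClosed A).measurableSet hs.measurableSet
      Set.subset_union_right hE₂.1) ?_ ?_ hf
  · rwa [h₁, h₂]
  · rwa [E₁.integralOn_star_id hs, E₂.integralOn_star_id hs, h₁, h₂]

end Intertwining

end SpectralMeasure

theorem isUnit_of_isUnit_coe_centralizer {𝕜 A : Type*} [CommSemiring 𝕜] [Semiring A] [Algebra 𝕜 A]
    {s : Set A} {a : Subalgebra.centralizer 𝕜 s} (ha : IsUnit (a : A)) : IsUnit a := by
  obtain ⟨u, hu⟩ := ha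
  have hinv : (u⁻¹ : Aˣ).val ∈ Subalgebra.centralizer 𝕜 s := fun d hd =>
    Commute.units_inv_right (hu ▸ a.2 d hd)
  exact isUnit_iff_exists.mpr
    ⟨⟨_, hinv⟩, Subtype.ext (by simp [← hu]), Subtype.ext (by simp [← hu])⟩

namespace KreinSpace

section Adjoint

variable {K₁ K₂ K₃ : Type*} [NormedAddCommGroup K₁] [NormedSpace ℂ K₁] [KreinSpace K₁]
  [NormedAddCommGroup K₂] [NormedSpace ℂ K₂] [KreinSpace K₂]
  [NormedAddCommGroup K₃] [NormedSpace ℂ K₃] [KreinSpace K₃]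

theorem adjoint_comp (S : K₂ →L[ℂ] K₃) (T : K₁ →L[ℂ] K₂) :
    adjoint (S ∘L T) = adjoint T ∘L adjoint S :=
  ContinuousLinearMap.ext fun y => form_ext_right fun x => by
    simp only [ContinuousLinearMap.comp_apply, form_adjoint_right]

theorem adjoint_adjoint (T : K₁ →L[ℂ] K₂) : adjoint (adjoint T) = T :=
  ContinuousLinearMap.ext fun y => form_ext_right fun x => by
    rw [form_adjoint_right, form_adjoint_left]

theorem adjoint_comp_adjoint_self (T : K₁ →L[ℂ] K₂) :
    adjoint (T ∘L adjoint T) = T ∘L adjoint T := by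
  rw [adjoint_comp, adjoint_adjoint]

theorem adjoint_adjoint_comp_self (T : K₁ →L[ℂ] K₂) :
    adjoint (adjoint T ∘L T) = adjoint T ∘L T := by
  rw [adjoint_comp, adjoint_adjoint]

theorem adjoint_mem_commutant {C D : K₁ →L[ℂ] K₁} (hD : adjoint D = D) (hC : C ∈ commutant D) :
    adjoint C ∈ commutant D := by
  have h := congrArg adjoint (mem_commutant.mp hC)
  simp only [ContinuousLinearMap.mul_def, adjoint_comp, hD] at h
  exact mem_commutant.mpr h.symm

end Adjoint

section Transport

variable {K H : Type*} [NormedAddCommGroup K] [NormedSpace ℂ K] [KreinSpace K]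
  [NormedAddCommGroup H] [InnerProductSpace ℂ H] [CompleteSpace H]
  {T : H →L[ℂ] K} (hT : Function.Injective T)

theorem comp_transport (C : commutant (T ∘L adjoint T)) :
    T ∘L (transport T hT C : H →L[ℂ] H) = C ∘L T :=
  ContinuousLinearMap.ext (apply_transport T hT C)

theorem transport_eq_of_comp_eq {C : commutant (T ∘L adjoint T)} {D : H →L[ℂ] H}
    (h : T ∘L D = C ∘L T) : (transport T hT C : H →L[ℂ] H) = D :=
  ContinuousLinearMap.ext fun x =>
    hT <| (apply_transport T hT C x).trans (DFunLike.congr_fun h x).symm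

theorem transport_comp_adjoint (C : commutant (T ∘L adjoint T)) :
    (transport T hT C : H →L[ℂ] H) ∘L adjoint T = adjoint T ∘L C :=
  ContinuousLinearMap.ext fun y => hT <| (apply_transport T hT C _).trans
    (DFunLike.congr_fun (mem_commutant.mp C.2) y).symm

theorem comp_adjoint_transport (C : commutant (T ∘L adjoint T)) :
    T ∘L adjoint (transport T hT C : H →L[ℂ] H) = adjoint C ∘L T := by
  have h := congrArg adjoint (transport_comp_adjoint hT C)
  simpa only [adjoint_comp, adjoint_adjoint] using h

theorem isStarNormal_transport {N : commutant (T ∘L adjoint T)}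
    (hN : N.1 * adjoint N.1 = adjoint N.1 * N.1) :
    IsStarNormal (transport T hT N : H →L[ℂ] H) := by
  set A : H →L[ℂ] H := (transport T hT N).1
  have hA x : T (A x) = N.1 (T x) := apply_transport T hT N x
  have hA' x : T (adjoint A x) = adjoint N.1 (T x) :=
    DFunLike.congr_fun (comp_adjoint_transport hT N) x
  refine ⟨ContinuousLinearMap.ext fun x => hT ?_⟩
  rw [ContinuousLinearMap.star_eq_adjoint, ← adjoint_eq_hilbert_adjoint]
  simpa only [mul_apply_eq_comp, hA, hA'] using (DFunLike.congr_fun hN (T x)).symm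

/-- The algebra homomorphism `C ↦ T⁻¹ C T` underlying `transport`. -/
noncomputable def transportAlgHom :
    commutant (T ∘L adjoint T) →ₐ[ℂ] commutant (adjoint T ∘L T) where
  toFun := transport T hT
  map_one' := Subtype.ext <| transport_eq_of_comp_eq hT rfl
  map_mul' C D := Subtype.ext <| transport_eq_of_comp_eq hT <| ContinuousLinearMap.ext fun x => by
    simp [apply_transport]
  map_zero' := Subtype.ext <| transport_eq_of_comp_eq hT <| by simp
  map_add' C D := Subtype.ext <| transport_eq_of_comp_eq hT <| ContinuousLinearMap.ext fun x => by
    simp [apply_transport]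
  commutes' c := Subtype.ext <| transport_eq_of_comp_eq hT <| ContinuousLinearMap.ext fun x => by
    simp [Algebra.algebraMap_eq_smul_one]

theorem spectrum_transport_subset (C : commutant (T ∘L adjoint T)) :
    spectrum ℂ (transport T hT C : H →L[ℂ] H) ⊆ spectrum ℂ (C : K →L[ℂ] K) :=
  calc spectrum ℂ (transport T hT C : H →L[ℂ] H)
    _ ⊆ spectrum ℂ C := AlgHom.spectrum_apply_subset
      ((commutant (adjoint T ∘L T)).val.comp (transportAlgHom hT)) C
    _ ⊆ spectrum ℂ (C : K →L[ℂ] K) := fun _ hz hu => hz (isUnit_of_isUnit_coe_centralizer hu)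

end Transport

section Factorization

variable {K H H₁ : Type*} [NormedAddCommGroup K] [NormedSpace ℂ K] [KreinSpace K]
  [NormedAddCommGroup H] [InnerProductSpace ℂ H] [CompleteSpace H]
  [NormedAddCommGroup H₁] [InnerProductSpace ℂ H₁] [CompleteSpace H₁]
  {T : H →L[ℂ] K} {S : H₁ →L[ℂ] K} {R : H₁ →L[ℂ] H}

theorem transport_mem_commutant_of_comp_eq (hT : Function.Injective T) (hTR : T ∘L R = S)
    {N : K →L[ℂ] K} (hNT : N ∈ commutant (T ∘L adjoint T))
    (hNS : N ∈ commutant (S ∘L adjoint S)) :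
    (transport T hT ⟨N, hNT⟩ : H →L[ℂ] H) ∈ commutant (R ∘L adjoint R) := by
  subst hTR
  set A : H →L[ℂ] H := (transport T hT ⟨N, hNT⟩).1
  rw [adjoint_comp] at hNS
  have hrange (y : K) : R (adjoint R (A (adjoint T y))) = A (R (adjoint R (adjoint T y))) := hT <|
    calc T (R (adjoint R (A (adjoint T y))))
      _ = T (R (adjoint R (adjoint T (N y)))) :=
        congrArg (T <| R <| adjoint R ·)
          (DFunLike.congr_fun (transport_comp_adjoint hT ⟨N, hNT⟩) y)
      _ = N (T (R (adjoint R (adjoint T y)))) := DFunLike.congr_fun (mem_commutant.mp hNS) y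
      _ = T (A (R (adjoint R (adjoint T y)))) := (apply_transport T hT ⟨N, hNT⟩ _).symm
  exact mem_commutant.mpr <| DFunLike.coe_injective <|
    (denseRange_adjoint hT).equalizer (by fun_prop) (by fun_prop) (funext hrange)

theorem transport_transport_of_comp_eq (hT : Function.Injective T) (hS : Function.Injective S)
    (hR : Function.Injective R) (hTR : T ∘L R = S) {N : K →L[ℂ] K}
    (hNT : N ∈ commutant (T ∘L adjoint T)) (hNS : N ∈ commutant (S ∘L adjoint S)) :
    transport R hR ⟨transport T hT ⟨N, hNT⟩, transport_mem_commutant_of_comp_eq hT hTR hNT hNS⟩ =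
      (transport S hS ⟨N, hNS⟩ : H₁ →L[ℂ] H₁) := by
  subst hTR
  exact transport_eq_of_comp_eq hR <| ContinuousLinearMap.ext fun x => hT <|
    (apply_transport (T ∘L R) hS ⟨N, hNS⟩ x).trans (apply_transport T hT ⟨N, hNT⟩ (R x)).symm

end Factorization

section SpectralIntegral

variable {H H₁ : Type*} [NormedAddCommGroup H] [InnerProductSpace ℂ H] [CompleteSpace H]
  [NormedAddCommGroup H₁] [InnerProductSpace ℂ H₁] [CompleteSpace H₁]
  {E : SpectralMeasure H} {f : ℂ → ℂ}

theorem integral_mem_commutant {A D : H →L[ℂ] H} (hE : E.IsSpectralMeasureOf A)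
    (hD : adjoint D = D) (hA : A ∈ commutant D) (hf : IsBoundedMeasurable f) :
    E.integral f ∈ commutant D := by
  have hA' := adjoint_mem_commutant hD hA
  rw [adjoint_eq_hilbert_adjoint] at hA'
  exact mem_commutant.mpr <| hE.comp_integral_eq_integral_comp hE (mem_commutant.mp hA)
    (mem_commutant.mp hA') hf

theorem transport_integral {R : H₁ →L[ℂ] H} (hR : Function.Injective R)
    {A : commutant (R ∘L adjoint R)} {E₁ : SpectralMeasure H₁}
    (hE : E.IsSpectralMeasureOf A.1) (hE₁ : E₁.IsSpectralMeasureOf (transport R hR A).1)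
    (hf : IsBoundedMeasurable f) :
    (transport R hR ⟨E.integral f,
      integral_mem_commutant hE (adjoint_comp_adjoint_self R) A.2 hf⟩ : H₁ →L[ℂ] H₁) =
      E₁.integral f := by
  have hadj := comp_adjoint_transport hR A
  simp only [adjoint_eq_hilbert_adjoint (H₁ := H), adjoint_eq_hilbert_adjoint] at hadj
  exact transport_eq_of_comp_eq hR <|
    hE₁.comp_integral_eq_integral_comp hE (comp_transport hR A) hadj hf

theorem exists_transport_integral_eq {R : H₁ →L[ℂ] H} (hR : Function.Injective R)
    {A : commutant (R ∘L adjoint R)} {E₁ : SpectralMeasure H₁}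
    (hE : E.IsSpectralMeasureOf A.1) (hE₁ : E₁.IsSpectralMeasureOf (transport R hR A).1)
    {D : H →L[ℂ] H} (hD : adjoint D = D) (hA : A.1 ∈ commutant D)
    {D₁ : H₁ →L[ℂ] H₁} (hD₁ : adjoint D₁ = D₁) (hA₁ : (transport R hR A).1 ∈ commutant D₁)
    (hf : IsBoundedMeasurable f) :
    ∃ hI : E.integral f ∈ commutant (R ∘L adjoint R) ⊓ commutant D,
      (transport R hR ⟨E.integral f, hI.1⟩ : H₁ →L[ℂ] H₁) = E₁.integral f ∧
      E₁.integral f ∈ commutant (adjoint R ∘L R) ⊓ commutant D₁ :=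
  ⟨⟨integral_mem_commutant hE (adjoint_comp_adjoint_self R) A.2 hf,
      integral_mem_commutant hE hD hA hf⟩,
    transport_integral hR hE hE₁ hf,
    integral_mem_commutant hE₁ (adjoint_adjoint_comp_self R) (transport R hR A).2 hf,
    integral_mem_commutant hE₁ hD₁ hA₁ hf⟩

end SpectralIntegral

end KreinSpace

theorem mainTheorem12 {K H : Type*} {m : ℕ} {Hs : Fin m → Type*}
    [NormedAddCommGroup K] [NormedSpace ℂ K] [KreinSpace K]
    [NormedAddCommGroup H] [InnerProductSpace ℂ H] [CompleteSpace H]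
    [∀ j, NormedAddCommGroup (Hs j)] [∀ j, InnerProductSpace ℂ (Hs j)]
    [∀ j, CompleteSpace (Hs j)]
    (T : H →L[ℂ] K) (Ts : ∀ j, Hs j →L[ℂ] K) (R : ∀ j, Hs j →L[ℂ] H)
    (hT : Function.Injective T) (hTs : ∀ j, Function.Injective (Ts j))
    (hR : ∀ j, Function.Injective (R j)) (hTR : ∀ j, T ∘L R j = Ts j)
    (j : Fin m) (N : K →L[ℂ] K)
    (hN : N * KreinSpace.adjoint N = KreinSpace.adjoint N * N)
    (hNj : N ∈ KreinSpace.commutant (Ts j ∘L KreinSpace.adjoint (Ts j)))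
    (hNT : N ∈ KreinSpace.commutant (T ∘L KreinSpace.adjoint T)) :
    let ΘN : H →L[ℂ] H := KreinSpace.transport T hT ⟨N, hNT⟩
    let ΘjN : Hs j →L[ℂ] Hs j := KreinSpace.transport (Ts j) (hTs j) ⟨N, hNj⟩
    let Γj : KreinSpace.commutant (R j ∘L KreinSpace.adjoint (R j)) →
        KreinSpace.commutant (KreinSpace.adjoint (R j) ∘L R j) :=
      KreinSpace.transport (R j) (hR j)
    let domH : Subalgebra ℂ (H →L[ℂ] H) :=
      KreinSpace.commutant (R j ∘L KreinSpace.adjoint (R j)) ⊓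
        KreinSpace.commutant (KreinSpace.adjoint T ∘L T)
    let domHj : Subalgebra ℂ (Hs j →L[ℂ] Hs j) :=
      KreinSpace.commutant (KreinSpace.adjoint (R j) ∘L R j) ⊓
        KreinSpace.commutant (KreinSpace.adjoint (Ts j) ∘L Ts j)
    spectrum ℂ ΘjN ⊆ spectrum ℂ ΘN ∧
    ∃ (hΘ : IsStarNormal ΘN) (hΘj : IsStarNormal ΘjN),
      let E : SpectralMeasure H := spectralMeasure ΘN hΘ
      let Ej : SpectralMeasure (Hs j) := spectralMeasure ΘjN hΘj
      (∀ Δ : Set ℂ, MeasurableSet Δ →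
        ∃ hE : E Δ ∈ domH, (Γj ⟨E Δ, hE.1⟩ : Hs j →L[ℂ] Hs j) = Ej Δ ∧ Ej Δ ∈ domHj) ∧
      (∀ h : ℂ → ℂ, Measurable ((spectrum ℂ ΘN).domRestrict h) →
        (∃ M : ℝ, ∀ z ∈ spectrum ℂ ΘN, ‖h z‖ ≤ M) →
        ∃ hI : E.integralOn (spectrum ℂ ΘN) h ∈ domH,
          (Γj ⟨E.integralOn (spectrum ℂ ΘN) h, hI.1⟩ : Hs j →L[ℂ] Hs j) =
            Ej.integralOn (spectrum ℂ ΘjN) h ∧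
          Ej.integralOn (spectrum ℂ ΘjN) h ∈ domHj) := by
  intro ΘN ΘjN Γj domH domHj
  have hΘR : ΘN ∈ KreinSpace.commutant (R j ∘L KreinSpace.adjoint (R j)) :=
    KreinSpace.transport_mem_commutant_of_comp_eq hT (hTR j) hNT hNj
  have hΓ : Γj ⟨ΘN, hΘR⟩ = ΘjN :=
    KreinSpace.transport_transport_of_comp_eq hT (hTs j) (hR j) (hTR j) hNT hNj
  have hσ : spectrum ℂ ΘjN ⊆ spectrum ℂ ΘN :=
    hΓ ▸ KreinSpace.spectrum_transport_subset (hR j) ⟨ΘN, hΘR⟩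
  refine ⟨hσ, KreinSpace.isStarNormal_transport hT hN,
    KreinSpace.isStarNormal_transport (hTs j) hN, ?_⟩
  intro E Ej
  have hE : E.IsSpectralMeasureOf ΘN := isSpectralMeasureOf_spectralMeasure ΘN _
  have hEj : Ej.IsSpectralMeasureOf ΘjN := isSpectralMeasureOf_spectralMeasure ΘjN _
  have transport_integral {f : ℂ → ℂ} (hf : IsBoundedMeasurable f) :=
    KreinSpace.exists_transport_integral_eq (hR j) (A := ⟨ΘN, hΘR⟩) hE (hΓ.symm ▸ hEj)
      (KreinSpace.adjoint_adjoint_comp_self T) (KreinSpace.transport T hT ⟨N, hNT⟩).2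
      (KreinSpace.adjoint_adjoint_comp_self (Ts j))
      (hΓ.symm ▸ (KreinSpace.transport (Ts j) (hTs j) ⟨N, hNj⟩).2) hf
  refine ⟨fun Δ hΔ => ?_, fun h hm hb => ?_⟩
  · simpa only [E.integral_indicator_const hΔ, Ej.integral_indicator_const hΔ, one_smul] using
      transport_integral ((IsBoundedMeasurable.const 1).indicator hΔ)
  · have hh := IsBoundedMeasurable.indicator_of_domRestrict
      (spectrum.isClosed ΘN).measurableSet hm hb
    rw [Ej.integralOn_eq_integralOn_of_subset (spectrum.isClosed ΘjN).measurableSet hσ hEj.1 hh]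
    exact transport_integral hh
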